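/- Let $\tau\in\mathbb{H}$, $\omega_0=0$, $\omega_1=1$, $\omega_2=\tau$, $\omega_3=1+\tau$, $\Lambda_\tau=\mathbb{Z}+\mathbb{Z}\tau$, $E_\tau=\mathbb{C}/\Lambda_\tau$, and let $E_\tau[2]$ be the set of classes of the points $\omega_k/2$, $k=0,1,2,3$. Let $\wp,\zeta,\sigma$ be the Weierstrass functions of the lattice $\Lambda_\tau$, and put $e_k=\wp(\omega_k/2)$, $\eta_k=2\zeta(\omega_k/2)$ for $k=1,2,3$. Let $\mathbf{n}=(n_0,n_1,n_2,n_3)$ be non-negative integers with $n_0\ge 1$, let $N=\sum_{k=0}^3 n_k$, and for $B\in\mathbb{C}$ let $\mathrm{H}(\mathbf{n},B,\tau)$ be the equation $$y''(z)=\Big[\sum_{k=0}^3 n_k(n_k+1)\,\wp\big(z+\tfrac{\omega_k}{2}\big)+B\Big]y(z).$$ Let $a_1,\dots,a_N\in\mathbb{C}$ satisfy $[a_i]\notin E_\tau[2]$ for all $i$ and $[a_i]\ne\pm[a_j]$ in $E_\tau$ for all $i\neq j$. For $c\in\mathbb{C}$ put $$y_{\boldsymbol a,c}(z)=e^{cz}\,\frac{\prod_{i=1}^N\sigma(z-a_i)}{\prod_{k=0}^3\sigma(z-\omega_k/2)^{n_k}},\qquad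 c(\boldsymbol a)=\sum_{i=1}^N\zeta(a_i)-\frac12\sum_{k=1}^3 n_k\eta_k .$$ Then the following three statements are equivalent: (i) $y_{\boldsymbol a,c(\boldsymbol a)}$ is a solution of $\mathrm{H}(\mathbf{n},B,\tau)$ for some $B\in\mathbb{C}$; (ii) $y_{\boldsymbol a,c}$ is a solution of $\mathrm{H}(\mathbf{n},B,\tau)$ for some $c,B\in\mathbb{C}$; (iii) $\displaystyle\sum_{i=1}^N\wp'(a_i)\,\wp(a_i)^l=0$ for all integers $l$ with $0\le l\le n_0-2$, and $\displaystyle\sum_{i=1}^N\wp'(a_i)\prod_{j\ne i}(\wp(a_j)-e_k)^l=0$ for all $k\in\{1,2,3\}$ and all integers $l$ with $1\le l\le n_k$. -/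

import Mathlib

noncomputable section

namespace GeneralizedLame

/-- The half-period data `ω₀ = 0`, `ω₁ = 1`, `ω₂ = τ`, `ω₃ = 1 + τ`. -/
def omega (τ : UpperHalfPlane) : Fin 4 → ℂ := ![0, 1, (τ : ℂ), 1 + (τ : ℂ)]

/-- The pair of periods `(1, τ)`; its lattice is `Λ_τ = ℤ + ℤτ`. -/
def periods (τ : UpperHalfPlane) : PeriodPair where
  ω₁ := 1
  ω₂ := (τ : ℂ)
  indep := by
    refine LinearIndependent.pair_iff.mpr fun s t h => ?_
    have him := congrArg Complex.im h
    have hre := congrArg Complex.re h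
    have ht : t = 0 := by
      have h0 : t * (τ : ℂ).im = 0 := by simpa using him
      exact (mul_eq_zero.mp h0).resolve_right τ.im_ne_zero
    subst ht
    exact ⟨by simpa using hre, rfl⟩

/-- The lattice `Λ_τ = ℤ + ℤτ`. -/
def Lam (τ : UpperHalfPlane) : Submodule ℤ ℂ := (periods τ).lattice

/-- The Weierstrass function `℘(z | τ)`. -/
def wp (τ : UpperHalfPlane) (z : ℂ) : ℂ := (periods τ).weierstrassP z

/-- The derivative `℘'(z | τ)`. -/
def wpDeriv (τ : UpperHalfPlane) (z : ℂ) : ℂ := (periods τ).derivWeierstrassP z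

/-- The Weierstrass zeta function
`ζ(z) = 1 / z + ∑_{l ≠ 0} (1 / (z - l) + 1 / l + z / l ^ 2)`.
The term `l = 0` of the sum below is `1 / z`, because `x / 0 = 0`. -/
def wzeta (τ : UpperHalfPlane) (z : ℂ) : ℂ :=
  ∑' l : Lam τ, (1 / (z - l) + 1 / (l : ℂ) + z / (l : ℂ) ^ 2)

/-- The Weierstrass sigma function
`σ(z) = z * ∏_{l ≠ 0} (1 - z / l) * exp (z / l + z ^ 2 / (2 * l ^ 2))`.
The factor `l = 0` of the product below is `1`, because `x / 0 = 0`. -/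
def wsigma (τ : UpperHalfPlane) (z : ℂ) : ℂ :=
  z * ∏' l : Lam τ, (1 - z / (l : ℂ)) * Complex.exp (z / (l : ℂ) + z ^ 2 / (2 * (l : ℂ) ^ 2))

/-- `e_k = ℘(ω_k / 2)`, used for `k = 1, 2, 3`. -/
def e (τ : UpperHalfPlane) (k : Fin 4) : ℂ := wp τ (omega τ k / 2)

/-- The quasi-periods `η_k = 2 ζ(ω_k / 2)`, used for `k = 1, 2, 3`. -/
def eta (τ : UpperHalfPlane) (k : Fin 4) : ℂ := 2 * wzeta τ (omega τ k / 2)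

/-- The points of `ℂ` whose class lies in `E_τ[2]`: `{ω_k / 2 | k = 0, 1, 2, 3} + Λ_τ`. -/
def twoTorsion (τ : UpperHalfPlane) : Set ℂ := {z | ∃ k : Fin 4, z - omega τ k / 2 ∈ Lam τ}

/-- The potential `I_n(z; B, τ) = ∑_k n_k (n_k + 1) ℘(z + ω_k / 2) + B`. -/
def potential (n : Fin 4 → ℕ) (B : ℂ) (τ : UpperHalfPlane) (z : ℂ) : ℂ :=
  (∑ k, (n k : ℂ) * ((n k : ℂ) + 1) * wp τ (z + omega τ k / 2)) + B

/-- The points at which the potential is holomorphic: the complement of the classes of those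
`ω_k / 2` with `n_k ≠ 0`. -/
def regularSet (n : Fin 4 → ℕ) (τ : UpperHalfPlane) : Set ℂ :=
  {z | ∀ k : Fin 4, n k ≠ 0 → z - omega τ k / 2 ∉ Lam τ}

/-- `y` is a solution of `H(n, B, τ) : y'' = I_n(z; B, τ) y`: it is holomorphic off the poles of
the potential and satisfies the equation there. -/
def IsSolution (n : Fin 4 → ℕ) (B : ℂ) (τ : UpperHalfPlane) (y : ℂ → ℂ) : Prop :=
  DifferentiableOn ℂ y (regularSet n τ) ∧
    ∀ z ∈ regularSet n τ, deriv (deriv y) z = potential n B τ z * y z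

/-- `e^{cz} ∏_i σ(z - a_i) / ∏_k σ(z - ω_k / 2)^{n_k}`. -/
def ansatz (n : Fin 4 → ℕ) (τ : UpperHalfPlane) {N : ℕ} (a : Fin N → ℂ) (c : ℂ) (z : ℂ) : ℂ :=
  Complex.exp (c * z) * (∏ i, wsigma τ (z - a i)) /
    ∏ k, wsigma τ (z - omega τ k / 2) ^ n k

/-- `c(a) = ∑_i ζ(a_i) - (1 / 2) ∑_{k = 1, 2, 3} n_k η_k`. -/
def cOf (n : Fin 4 → ℕ) (τ : UpperHalfPlane) {N : ℕ} (a : Fin N → ℂ) : ℂ :=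
  (∑ i, wzeta τ (a i)) - (1 / 2) * ∑ k ∈ ({1, 2, 3} : Finset (Fin 4)), (n k : ℂ) * eta τ k

end GeneralizedLame

end

noncomputable section

namespace GeneralizedLame

open Filter Topology Set
open scoped PeriodPair

variable (τ : UpperHalfPlane)

/-! ### The Weierstrass zeta function -/

/-! Write `L = y' / y` for the ansatz. Away from the zeros and poles of `y`, the equation says that
the Riccati expression `f = L' + L²` equals the potential. The potential is even, so `f` must be
even. The main point is the converse: evenness of `f` already produces a `B`.

Since `N = ∑ n_k`, the quasi-periods cancel and `f` is elliptic. Its double poles agree with those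
of the potential: at `ω_k / 2` the coefficient is `n_k + n_k² = n_k (n_k + 1)`, and at `a_i` it is
`-1 + 1 = 0`. Evenness removes the remaining simple poles: the residue at a half period vanishes by
reflection about it, and a pole at `a_i` would be mirrored at `-a_i`, where `f` is regular. By
Liouville, `f` minus the `℘`-part of the potential is a constant `B`
(`exists_riccati_eq_potential`).

Evenness is algebraic in `℘`. Put `Q = ∏ (X - ℘(a_i))`, `W = ∑ ℘'(a_i) ∏_{j ≠ i} (X - ℘(a_j))` and
`R = ∏_{k ≠ 0} (X - e_k)^{n_k}`. For `c = c(a)`, the addition formula for `ζ` gives `L(z) + L(-z) =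
(W / Q)(℘)` and `L(z) - L(-z) = ℘' (Q' / Q - R' / R)(℘)`, so that `f(z) - f(-z) = ℘' ((W' R - W R')
/ (Q R))(℘)` (`riccati_sub_riccati_neg`). Hence `f` is even iff this Wronskian vanishes, iff `W = b
R` for a constant `b`. As `deg R = N - n_0`, this means that `deg W ≤ N - n_0` and that each `(X -
e_k)^{n_k}` divides `W`. Expanding `W / Q` at infinity and at the `e_k` turns these two demands into
the two families of sums in (iii) (`weightedNodes_eq_C_mul_iff`).

For an arbitrary exponent `c`, the residue of `f` minus the potential at `0` is `-2 n_0 (c - c(a))`.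
Because `n_0 ≥ 1`, a solution forces `c = c(a)` (`eq_cOf_of_isSolution`), which links (ii) to (i).
-/

lemma wzeta_summand_bound (r : ℝ) (hr : 0 < r) (s : ℂ) (hs : ‖s‖ < r) (l : ℂ) (h : 2 * r ≤ ‖l‖) :
    ‖1 / (s - l) + 1 / l + s / l ^ 2‖ ≤ 2 * r ^ 2 * ‖l‖ ^ (-3 : ℝ) := by
  have hsl : s - l ≠ 0 := by
    intro h0; rw [sub_eq_zero] at h0; subst h0; linarith
  have hl : 0 < ‖l‖ := by linarith
  have hl0 : l ≠ 0 := norm_pos_iff.mp hl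
  have hd : ‖l‖ / 2 ≤ ‖s - l‖ := by
    rw [norm_sub_rev]
    exact le_trans (by linarith) (norm_sub_norm_le l s)
  -- The terms `1 / l + s / l ^ 2` cancel the expansion of `1 / (s - l)` in `s / l` through first
  -- order; what is left is of size `‖l‖ ^ (-3)`, summable over a lattice of rank two.
  have e1 : 1 / (s - l) + 1 / l + s / l ^ 2 = s ^ 2 / ((s - l) * l ^ 2) := by
    field_simp
    ring
  have e2 : ‖l‖ ^ (-3 : ℝ) = (‖l‖ ^ 3)⁻¹ := by
    rw [Real.rpow_neg hl.le]; norm_cast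
  rw [e1, e2, norm_div, norm_mul, norm_pow, norm_pow]
  calc ‖s‖ ^ 2 / (‖s - l‖ * ‖l‖ ^ 2) ≤ r ^ 2 / (‖l‖ / 2 * ‖l‖ ^ 2) := by gcongr
    _ = 2 * r ^ 2 * (‖l‖ ^ 3)⁻¹ := by field_simp

/-- The Weierstrass zeta function with the `l₀`-term missing. -/
def wzetaExcept (l₀ z : ℂ) : ℂ :=
  ∑' l : Lam τ, if (l : ℂ) = l₀ then 0 else 1 / (z - l) + 1 / (l : ℂ) + z / (l : ℂ) ^ 2

lemma hasSumLocallyUniformly_wzetaExcept (l₀ : ℂ) :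
    HasSumLocallyUniformly (fun (l : Lam τ) (z : ℂ) ↦
      if (l : ℂ) = l₀ then 0 else 1 / (z - l) + 1 / (l : ℂ) + z / (l : ℂ) ^ 2)
      (wzetaExcept τ l₀) := by
  refine (periods τ).hasSumLocallyUniformly_aux (u := (2 * · ^ 2 * ‖·‖ ^ (-3 : ℝ))) _
    (fun _ _ ↦ (ZLattice.summable_norm_rpow _ _ (by simp; norm_num)).mul_left _) fun r hr ↦
    Filter.eventually_atTop.mpr ⟨2 * r, ?_⟩
  rintro _ h s hs l rfl
  split_ifs
  · simpa using! show 0 ≤ 2 * r ^ 2 * (‖(l : ℂ)‖ ^ 3)⁻¹ by positivity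
  · exact wzeta_summand_bound r hr s hs l h

lemma summable_wzetaExcept (l₀ z : ℂ) : Summable fun l : Lam τ ↦
    if (l : ℂ) = l₀ then 0 else 1 / (z - l) + 1 / (l : ℂ) + z / (l : ℂ) ^ 2 :=
  (hasSumLocallyUniformly_wzetaExcept τ l₀).hasSum.summable

lemma isOpen_compl_Lam_sdiff (l₀ : ℂ) : IsOpen ((Lam τ : Set ℂ) \ {l₀})ᶜ :=
  (periods τ).isOpen_compl_lattice_sdiff

lemma isOpen_compl_Lam : IsOpen (Lam τ : Set ℂ)ᶜ :=
  (periods τ).isClosed_lattice.isOpen_compl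

lemma isPreconnected_compl_Lam : IsPreconnected (Lam τ : Set ℂ)ᶜ := by
  have : Countable (periods τ).lattice :=
    (periods τ).latticeEquivProd.injective.countable
  refine (Set.Countable.isConnected_compl_of_one_lt_rank (by simp) ?_).2
  exact Set.countable_coe_iff.mp this

/-- Locally uniform convergence of holomorphic terms allows termwise differentiation, and the
differentiated terms are those of the `℘` series with the sign reversed. -/
lemma hasDerivAt_wzetaExcept (l₀ : ℂ) {x : ℂ} (hx : x ∈ ((Lam τ : Set ℂ) \ {l₀})ᶜ) :
    HasDerivAt (wzetaExcept τ l₀) (-(periods τ).weierstrassPExcept l₀ x) x := by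
  have hne : ∀ (i : Lam τ), (i : ℂ) ≠ l₀ → ∀ y ∈ ((Lam τ : Set ℂ) \ {l₀})ᶜ, y - i ≠ 0 := by
    intro i hi y hy h0
    rw [sub_eq_zero] at h0
    subst h0
    exact hy ⟨i.2, hi⟩
  have hdt : ∀ (i : Lam τ), ∀ y ∈ ((Lam τ : Set ℂ) \ {l₀})ᶜ, HasDerivAt
      (fun z : ℂ ↦ if (i : ℂ) = l₀ then 0 else 1 / (z - i) + 1 / (i : ℂ) + z / (i : ℂ) ^ 2)
      (-(if (i : ℂ) = l₀ then 0 else 1 / (y - i) ^ 2 - 1 / (i : ℂ) ^ 2)) y := by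
    intro i y hy
    split_ifs with hi
    · simpa using hasDerivAt_const y (0 : ℂ)
    have h1 := ((((hasDerivAt_id y).sub_const (i : ℂ)).inv (hne i hi y hy)).add_const
      (1 / (i : ℂ))).add ((hasDerivAt_id y).div_const ((i : ℂ) ^ 2))
    refine (h1.congr_deriv ?_).congr_of_eventuallyEq ?_
    · simp [id]; ring
    · exact .of_forall fun z ↦ by simp [id]
  have hopen := isOpen_compl_Lam_sdiff τ l₀
  have hd : DifferentiableOn ℂ (wzetaExcept τ l₀) ((Lam τ : Set ℂ) \ {l₀})ᶜ :=
    (hasSumLocallyUniformly_wzetaExcept τ l₀).hasSumLocallyUniformlyOn.differentiableOn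
      (.of_forall fun s ↦ .fun_sum fun i _ y hy ↦
        (hdt i y hy).differentiableAt.differentiableWithinAt) hopen
  have hder : deriv (wzetaExcept τ l₀) x = -(periods τ).weierstrassPExcept l₀ x := by
    have t1 := ((hasSumLocallyUniformly_wzetaExcept τ l₀).tendstoLocallyUniformlyOn.deriv
      (.of_forall fun s ↦ .fun_sum fun i _ y hy ↦
        (hdt i y hy).differentiableAt.differentiableWithinAt) hopen).tendsto_at hx
    have t2 := ((periods τ).hasSum_weierstrassPExcept l₀ x).neg
    refine tendsto_nhds_unique (t1.congr fun s ↦ ?_) t2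
    simp only [Function.comp_apply]
    rw [deriv_fun_sum fun i _ ↦ (hdt i x hx).differentiableAt]
    exact Finset.sum_congr rfl fun i _ ↦ (hdt i x hx).deriv
  rw [← hder]
  exact (hd.differentiableAt (hopen.mem_nhds hx)).hasDerivAt

lemma wzetaExcept_add (l₀ : Lam τ) (z : ℂ) :
    wzetaExcept τ l₀ z + (1 / (z - l₀) + 1 / (l₀ : ℂ) + z / (l₀ : ℂ) ^ 2) = wzeta τ z := by
  trans wzetaExcept τ l₀ z + ∑' i : Lam τ,
    if (i : ℂ) = l₀ then (1 / (z - l₀) + 1 / (l₀ : ℂ) + z / (l₀ : ℂ) ^ 2) else 0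
  · simp
  rw [wzetaExcept, wzeta, ← Summable.tsum_add (summable_wzetaExcept τ _ z)]
  · congr with w
    split_ifs with h
    · simp [h]
    · simp
  · exact summable_of_hasFiniteSupport ((Set.finite_singleton l₀).subset (by simp))

lemma wzetaExcept_of_notMem {l₀ : ℂ} (h : l₀ ∉ Lam τ) : wzetaExcept τ l₀ = wzeta τ := by
  ext z
  unfold wzetaExcept wzeta
  exact tsum_congr fun l ↦ if_neg fun h' ↦ h (by rw [← h']; exact l.2)

lemma hasDerivAt_wzeta {z : ℂ} (hz : z ∉ Lam τ) : HasDerivAt (wzeta τ) (-wp τ z) z := by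
  have h := hasDerivAt_wzetaExcept τ z (x := z) (by simp)
  rw [wzetaExcept_of_notMem τ hz] at h
  have hz' : z ∉ (periods τ).lattice := hz
  rwa [(periods τ).weierstrassPExcept_of_notMem z hz'] at h

@[simp] lemma wzeta_neg (z : ℂ) : wzeta τ (-z) = -wzeta τ z := by
  unfold wzeta
  rw [← (Equiv.neg (Lam τ)).tsum_eq, ← tsum_neg]
  congr with l
  simp only [Equiv.neg_apply, NegMemClass.coe_neg, sub_neg_eq_add]
  rw [show -z + (l : ℂ) = -(z - l) by ring]
  simp only [div_neg, neg_div, even_two.neg_pow]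
  ring

@[simp] lemma wzeta_zero : wzeta τ 0 = 0 := by
  have := wzeta_neg τ 0
  rw [neg_zero] at this
  exact CharZero.eq_neg_self_iff.mp this

lemma add_mem_Lam_iff {z l : ℂ} (hl : l ∈ Lam τ) : z + l ∈ Lam τ ↔ z ∈ Lam τ :=
  Submodule.add_mem_iff_left _ hl

/-- Quasi-periodicity of the zeta function. -/
lemma exists_wzeta_add {l : ℂ} (hl : l ∈ Lam τ) :
    ∃ h : ℂ, ∀ z ∉ Lam τ, wzeta τ (z + l) = wzeta τ z + h := by
  have hd : ∀ z ∉ Lam τ, HasDerivAt (fun z ↦ wzeta τ (z + l) - wzeta τ z) 0 z := by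
    intro z hz
    have h1 := hasDerivAt_wzeta τ (z := z + l) (by rwa [add_mem_Lam_iff τ hl])
    have h2 := (h1.comp_add_const z l).sub (hasDerivAt_wzeta τ hz)
    refine h2.congr_deriv ?_
    have := (periods τ).weierstrassP_add_coe z ⟨l, hl⟩
    rw [wp, wp, this, sub_self]
  obtain ⟨h, hh⟩ := (isOpen_compl_Lam τ).exists_is_const_of_deriv_eq_zero
    (isPreconnected_compl_Lam τ) (fun z hz ↦ (hd z hz).differentiableAt.differentiableWithinAt)
    (fun z hz ↦ (hd z hz).deriv)
  exact ⟨h, fun z hz ↦ by rw [← hh z hz]; ring⟩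

/-! ### Regularity of `℘`, `℘'` and `ζ` -/

lemma analyticAt_wp {z : ℂ} (hz : z ∉ Lam τ) : AnalyticAt ℂ (wp τ) z :=
  (periods τ).analyticOnNhd_weierstrassP z hz

lemma analyticAt_wpDeriv {z : ℂ} (hz : z ∉ Lam τ) : AnalyticAt ℂ (wpDeriv τ) z :=
  (periods τ).analyticOnNhd_derivWeierstrassP z hz

lemma analyticAt_wzeta {z : ℂ} (hz : z ∉ Lam τ) : AnalyticAt ℂ (wzeta τ) z :=
  DifferentiableOn.analyticAt (s := (Lam τ : Set ℂ)ᶜ)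
    (fun _ hx ↦ (hasDerivAt_wzeta τ hx).differentiableAt.differentiableWithinAt)
    ((isOpen_compl_Lam τ).mem_nhds hz)

lemma hasDerivAt_wp {z : ℂ} (hz : z ∉ Lam τ) : HasDerivAt (wp τ) (wpDeriv τ z) z := by
  have := (analyticAt_wp τ hz).differentiableAt.hasDerivAt
  have h : deriv (wp τ) z = wpDeriv τ z := by
    change deriv (periods τ).weierstrassP z = _
    rw [(periods τ).deriv_weierstrassP]; rfl
  rwa [h] at this

@[simp] lemma wp_neg (z : ℂ) : wp τ (-z) = wp τ z := (periods τ).weierstrassP_neg z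
@[simp] lemma wpDeriv_neg (z : ℂ) : wpDeriv τ (-z) = -wpDeriv τ z :=
  (periods τ).derivWeierstrassP_neg z
lemma wp_add {l : ℂ} (hl : l ∈ Lam τ) (z : ℂ) : wp τ (z + l) = wp τ z :=
  (periods τ).weierstrassP_add_coe z ⟨l, hl⟩
lemma wpDeriv_add {l : ℂ} (hl : l ∈ Lam τ) (z : ℂ) : wpDeriv τ (z + l) = wpDeriv τ z :=
  (periods τ).derivWeierstrassP_add_coe z ⟨l, hl⟩

/-- The Laurent expansions of `ζ`, `℘` and `℘'` at `0`. -/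
lemma exists_expansion_zero : ∃ s p q : ℂ → ℂ, AnalyticAt ℂ s 0 ∧ AnalyticAt ℂ p 0 ∧
    AnalyticAt ℂ q 0 ∧ s 0 = 0 ∧ HasDerivAt s 0 0 ∧ p 0 = 0 ∧
    (∀ z, wzeta τ z = 1 / z + s z) ∧ (∀ z, wp τ z = 1 / z ^ 2 + p z) ∧
    ∀ z, wpDeriv τ z = -2 / z ^ 3 + q z := by
  have hz (z : ℂ) : wzeta τ z = 1 / z + wzetaExcept τ 0 z := by
    have := wzetaExcept_add τ 0 z
    simp only [ZeroMemClass.coe_zero, sub_zero, div_zero, ne_eq, OfNat.ofNat_ne_zero,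
      not_false_eq_true, zero_pow, add_zero] at this
    rw [← this]; ring
  refine ⟨wzetaExcept τ 0, (periods τ).weierstrassPExcept 0, (periods τ).derivWeierstrassPExcept 0,
    ?_, (periods τ).analyticAt_weierstrassPExcept 0,
    (periods τ).analyticAt_derivWeierstrassPExcept 0,
    ?_, ?_, (periods τ).weierstrassPExcept_zero 0, hz, ?_, ?_⟩
  · exact DifferentiableOn.analyticAt (s := ((Lam τ : Set ℂ) \ {0})ᶜ)
      (fun _ hx ↦ (hasDerivAt_wzetaExcept τ 0 hx).differentiableAt.differentiableWithinAt)
      ((isOpen_compl_Lam_sdiff τ 0).mem_nhds (by simp))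
  · simpa using (hz 0).symm
  · simpa using hasDerivAt_wzetaExcept τ 0 (x := 0) (by simp)
  · intro z
    have := (periods τ).weierstrassPExcept_add 0 z
    simp only [ZeroMemClass.coe_zero, sub_zero, div_zero, ne_eq, OfNat.ofNat_ne_zero,
      not_false_eq_true, zero_pow] at this
    rw [wp, ← this]; ring
  · intro z
    have := (periods τ).derivWeierstrassPExcept_sub 0 z
    simp only [ZeroMemClass.coe_zero, sub_zero] at this
    rw [wpDeriv, ← this]; ring

/-! ### The Weierstrass sigma function -/

/-- The exponent is chosen so that this derivative has a double zero at `0`. Integrating it gives `1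
+ O(w³)` for the factor, the rate needed for the product over the lattice. -/
lemma hasDerivAt_elementary_factor (w : ℂ) :
    HasDerivAt (fun w : ℂ ↦ (1 - w) * Complex.exp (w + w ^ 2 / 2))
      (-w ^ 2 * Complex.exp (w + w ^ 2 / 2)) w := by
  have h1 := ((hasDerivAt_id w).const_sub 1).mul
    ((hasDerivAt_id w).add (((hasDerivAt_id w).pow 2).div_const 2)).cexp
  refine h1.congr_deriv ?_
  simp [id]
  ring

lemma norm_elementary_factor_sub_one_le {w : ℂ} (hw : ‖w‖ ≤ 1) :
    ‖(1 - w) * Complex.exp (w + w ^ 2 / 2) - 1‖ ≤ Real.exp 2 * ‖w‖ ^ 3 := by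
  have := (convex_closedBall (0 : ℂ) ‖w‖).norm_image_sub_le_of_norm_hasDerivWithin_le
    (f := fun w : ℂ ↦ (1 - w) * Complex.exp (w + w ^ 2 / 2))
    (f' := fun w : ℂ ↦ -w ^ 2 * Complex.exp (w + w ^ 2 / 2)) (C := ‖w‖ ^ 2 * Real.exp 2)
    (x := 0) (y := w) (fun x _ ↦ (hasDerivAt_elementary_factor x).hasDerivWithinAt)
    (fun x hx ↦ ?_) (by simp) (by simp)
  · simp only [sub_zero] at this
    refine le_trans (le_of_eq ?_) (this.trans (le_of_eq ?_))
    · simp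
    · ring
  · have hx' : ‖x‖ ≤ ‖w‖ := by simpa using hx
    have hx1 : ‖x‖ ≤ 1 := hx'.trans hw
    rw [norm_mul, norm_neg, norm_pow, Complex.norm_exp]
    gcongr
    calc (x + x ^ 2 / 2).re ≤ ‖x + x ^ 2 / 2‖ := Complex.re_le_norm _
      _ ≤ ‖x‖ + ‖x‖ ^ 2 / 2 := by
        refine (norm_add_le _ _).trans (le_of_eq ?_)
        simp
      _ ≤ 2 := by nlinarith [norm_nonneg x]

/-- The factor of the sigma product at the lattice point `l`. -/
def sigmaFactor (l z : ℂ) : ℂ := (1 - z / l) * Complex.exp (z / l + z ^ 2 / (2 * l ^ 2))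

lemma sigmaFactor_eq (l z : ℂ) :
    sigmaFactor l z = (1 - z / l) * Complex.exp (z / l + (z / l) ^ 2 / 2) := by
  rw [sigmaFactor]; congr 3; rw [div_pow, div_div, mul_comm]

lemma sigmaFactor_bound {r : ℝ} {z l : ℂ} (hz : ‖z‖ < r) (hl : r ≤ ‖l‖) :
    ‖sigmaFactor l z - 1‖ ≤ Real.exp 2 * r ^ 3 * ‖l‖ ^ (-3 : ℝ) := by
  have hr : 0 < r := (norm_nonneg z).trans_lt hz
  have hl0 : 0 < ‖l‖ := by linarith
  have e2 : ‖l‖ ^ (-3 : ℝ) = (‖l‖ ^ 3)⁻¹ := by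
    rw [Real.rpow_neg hl0.le]; norm_cast
  rw [sigmaFactor_eq]
  refine (norm_elementary_factor_sub_one_le ?_).trans ?_
  · rw [norm_div, div_le_one hl0]; linarith
  · rw [norm_div, div_pow, e2, mul_assoc, div_eq_mul_inv]
    gcongr

lemma differentiable_sigmaFactor (l : ℂ) : Differentiable ℂ (sigmaFactor l) := by
  unfold sigmaFactor
  fun_prop

lemma sigmaFactor_ne_zero {l z : ℂ} (h : z ≠ l) : sigmaFactor l z ≠ 0 := by
  refine mul_ne_zero ?_ (Complex.exp_ne_zero _)
  by_cases hl : l = 0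
  · simp [hl]
  · rw [sub_ne_zero]
    exact fun h' ↦ h ((div_eq_one_iff_eq hl).mp h'.symm)

lemma logDeriv_sigmaFactor {l z : ℂ} (h : z ≠ l) :
    logDeriv (sigmaFactor l) z = if l = 0 then 0 else 1 / (z - l) + 1 / l + z / l ^ 2 := by
  split_ifs with hl
  · subst hl
    have : sigmaFactor 0 = fun _ ↦ 1 := by ext w; simp [sigmaFactor]
    simp [this]
  · have h1 : HasDerivAt (sigmaFactor l)
        (-(z / l) ^ 2 * Complex.exp (z / l + (z / l) ^ 2 / 2) * (1 / l)) z := by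
      have h2 := (hasDerivAt_elementary_factor (z / l)).comp z ((hasDerivAt_id z).div_const l)
      refine h2.congr_of_eventuallyEq (.of_forall fun w ↦ ?_)
      simp [sigmaFactor_eq]
    have hzl : z - l ≠ 0 := sub_ne_zero.mpr h
    have hzl' : 1 - z / l ≠ 0 := by
      rw [sub_ne_zero]
      exact fun h' ↦ h ((div_eq_one_iff_eq hl).mp h'.symm)
    rw [logDeriv_apply, h1.deriv, sigmaFactor_eq]
    have he := Complex.exp_ne_zero (z / l + (z / l) ^ 2 / 2)
    rw [show -(z / l) ^ 2 * Complex.exp (z / l + (z / l) ^ 2 / 2) * (1 / l) /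
      ((1 - z / l) * Complex.exp (z / l + (z / l) ^ 2 / 2)) =
      -(z / l) ^ 2 * (1 / l) / (1 - z / l) by field_simp]
    have : 1 - z / l = -(z - l) / l := by field_simp; ring
    rw [this]
    field_simp
    ring

lemma eventually_sigmaFactor_bound (r : ℝ) :
    ∀ᶠ l : Lam τ in cofinite, ∀ z ∈ Metric.ball (0 : ℂ) r,
      ‖sigmaFactor l z - 1‖ ≤ Real.exp 2 * r ^ 3 * ‖l‖ ^ (-3 : ℝ) := by
  have : ProperSpace (Lam τ) := inferInstanceAs (ProperSpace (periods τ).lattice)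
  have : DiscreteTopology (Lam τ) := inferInstanceAs (DiscreteTopology (periods τ).lattice)
  refine (isCompact_iff_finite.mp (isCompact_closedBall (0 : Lam τ) r)).subset fun l hl ↦ ?_
  simp only [Metric.mem_closedBall, dist_zero_right]
  by_contra! h
  exact hl fun z hz ↦ sigmaFactor_bound (by simpa using hz) h.le

lemma summable_norm_Lam : Summable fun l : Lam τ ↦ ‖l‖ ^ (-3 : ℝ) :=
  ZLattice.summable_norm_rpow (periods τ).lattice _ (by simp; norm_num)

lemma multipliableLocallyUniformlyOn_sigmaFactor (r : ℝ) :
    MultipliableLocallyUniformlyOn (fun (l : Lam τ) z ↦ sigmaFactor l z)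
      (Metric.ball (0 : ℂ) r) := by
  have := Summable.multipliableLocallyUniformlyOn_one_add (K := Metric.ball (0 : ℂ) r)
    Metric.isOpen_ball ((summable_norm_Lam τ).mul_left (Real.exp 2 * r ^ 3)) (eventually_sigmaFactor_bound τ r)
    (fun l ↦ ((differentiable_sigmaFactor l).sub_const 1).continuous.continuousOn)
  simpa using this

lemma differentiable_tprod_sigmaFactor :
    Differentiable ℂ fun z ↦ ∏' l : Lam τ, sigmaFactor l z := by
  intro x
  have h := (multipliableLocallyUniformlyOn_sigmaFactor τ
    (‖x‖ + 1)).hasProdLocallyUniformlyOn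
  rw [hasProdLocallyUniformlyOn_iff_tendstoLocallyUniformlyOn] at h
  exact (h.differentiableOn (.of_forall fun s ↦ by
    exact DifferentiableOn.fun_finsetProd fun l _ ↦ (differentiable_sigmaFactor l).differentiableOn)
    Metric.isOpen_ball).differentiableAt (Metric.isOpen_ball.mem_nhds (by simp))

lemma tprod_sigmaFactor_ne_zero {z : ℂ} (hz : z ∉ Lam τ) : ∏' l : Lam τ, sigmaFactor l z ≠ 0 := by
  have h := tprod_one_add_ne_zero_of_summable (f := fun l : Lam τ ↦ sigmaFactor l z - 1) ?_ ?_
  · simpa using h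
  · intro l
    rw [add_sub_cancel]
    exact sigmaFactor_ne_zero fun h ↦ hz (by rw [h]; exact l.2)
  · refine ((summable_norm_Lam τ).mul_left
      (Real.exp 2 * (‖z‖ + 1) ^ 3)).of_norm_bounded_eventually ?_
    filter_upwards [eventually_sigmaFactor_bound τ (‖z‖ + 1)] with l hl
    simpa using hl z (by simp)

lemma differentiable_wsigma : Differentiable ℂ (wsigma τ) :=
  differentiable_id.mul (differentiable_tprod_sigmaFactor τ)

lemma ne_zero_of_notMem_Lam {z : ℂ} (hz : z ∉ Lam τ) : z ≠ 0 := by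
  rintro rfl; exact hz (zero_mem _)

lemma wsigma_ne_zero {z : ℂ} (hz : z ∉ Lam τ) : wsigma τ z ≠ 0 :=
  mul_ne_zero (ne_zero_of_notMem_Lam τ hz) (tprod_sigmaFactor_ne_zero τ hz)

/-- Logarithmic differentiation of the product, factor by factor, gives the `ζ` series without its
`l = 0` term; the prefactor `z` supplies the missing `1 / z`. -/
lemma logDeriv_wsigma {z : ℂ} (hz : z ∉ Lam τ) : logDeriv (wsigma τ) z = wzeta τ z := by
  have hne (l : Lam τ) : z ≠ l := fun h ↦ hz (by rw [h]; exact l.2)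
  have hl : ∀ l : Lam τ, logDeriv (sigmaFactor l) z =
      if (l : ℂ) = 0 then 0 else 1 / (z - l) + 1 / (l : ℂ) + z / (l : ℂ) ^ 2 :=
    fun l ↦ logDeriv_sigmaFactor (hne l)
  have h := logDeriv_tprod_eq_tsum (Metric.isOpen_ball (x := (0 : ℂ)) (ε := ‖z‖ + 1))
    (x := z) (by simp) (f := fun (l : Lam τ) z ↦ sigmaFactor l z)
    (fun l ↦ sigmaFactor_ne_zero (hne l))
    (fun l ↦ (differentiable_sigmaFactor l).differentiableOn)
    ((summable_wzetaExcept τ 0 z).congr fun l ↦ (hl l).symm)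
    (multipliableLocallyUniformlyOn_sigmaFactor τ _) (tprod_sigmaFactor_ne_zero τ hz)
  change logDeriv (fun z ↦ z * ∏' l : Lam τ, sigmaFactor l z) z = _
  rw [logDeriv_mul z (ne_zero_of_notMem_Lam τ hz) (tprod_sigmaFactor_ne_zero τ hz)
    differentiableAt_fun_id (differentiable_tprod_sigmaFactor τ z), h, ← wzetaExcept_add τ 0 z,
    wzetaExcept, tsum_congr hl]
  simp [logDeriv_apply, add_comm]

lemma hasDerivAt_wsigma {z : ℂ} (hz : z ∉ Lam τ) :
    HasDerivAt (wsigma τ) (wzeta τ z * wsigma τ z) z := by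
  refine (differentiable_wsigma τ z).hasDerivAt.congr_deriv ?_
  rw [← logDeriv_wsigma τ hz, logDeriv_apply, div_mul_cancel₀ _ (wsigma_ne_zero τ hz)]

/-! ### Liouville's theorem for elliptic functions -/

lemma eventually_sub_notMem_Lam (z₀ a : ℂ) : ∀ᶠ z in 𝓝[≠] z₀, z - a ∉ Lam τ := by
  have h := (periods τ).compl_lattice_sdiff_singleton_mem_nhds (z₀ - a)
  have ht : Tendsto (fun z : ℂ ↦ z - a) (𝓝 z₀) (𝓝 (z₀ - a)) :=
    (continuous_id.sub continuous_const).tendsto z₀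
  filter_upwards [mem_nhdsWithin_of_mem_nhds (ht h), self_mem_nhdsWithin] with z hz hne hmem
  refine hz ⟨hmem, fun h ↦ hne ?_⟩
  simpa using h

lemma eventually_notMem_Lam (z₀ : ℂ) : ∀ᶠ z in 𝓝[≠] z₀, z ∉ Lam τ := by
  simpa using eventually_sub_notMem_Lam τ z₀ 0

lemma tendsto_nhdsNE_of_eventuallyEq_analyticAt {H g : ℂ → ℂ} {z₀ : ℂ} (hg : AnalyticAt ℂ g z₀)
    (h : H =ᶠ[𝓝[≠] z₀] g) : Tendsto H (𝓝[≠] z₀) (𝓝 (g z₀)) :=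
  (hg.continuousAt.tendsto.mono_left nhdsWithin_le_nhds).congr' h.symm

lemma eventually_nhdsNE_of_eventually_nhdsNE {p : ℂ → Prop} {z₀ : ℂ} (h : ∀ᶠ z in 𝓝[≠] z₀, p z) :
    ∀ᶠ y in 𝓝[≠] z₀, ∀ᶠ z in 𝓝[≠] y, p z := by
  filter_upwards [eventually_eventually_nhdsWithin.mpr h, self_mem_nhdsWithin] with y hy hne
  rw [isOpen_compl_singleton.nhdsWithin_eq hne] at hy
  exact hy.filter_mono nhdsWithin_le_nhds

lemma tendsto_add_right_nhdsNE (z₀ l : ℂ) : Tendsto (· + l) (𝓝[≠] z₀) (𝓝[≠] (z₀ + l)) := by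
  refine tendsto_nhdsWithin_of_tendsto_nhds_of_eventually_within _
    (((continuous_id.add continuous_const).tendsto z₀).mono_left nhdsWithin_le_nhds) ?_
  filter_upwards [self_mem_nhdsWithin] with z hz h
  exact hz (by simpa using h)

/-- A `Λ_τ`-periodic function that extends holomorphically across every point of a fundamental
domain is constant off its removable singularities. -/
theorem exists_eventually_eq_const {H : ℂ → ℂ}
    (hper : ∀ l ∈ Lam τ, ∀ z₀, ∀ᶠ z in 𝓝[≠] z₀, H (z + l) = H z)
    (hloc : ∀ z₀, ∃ l ∈ Lam τ, ∃ g, AnalyticAt ℂ g (z₀ + l) ∧ H =ᶠ[𝓝[≠] (z₀ + l)] g) :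
    ∃ C, ∀ z₀, ∀ᶠ z in 𝓝[≠] z₀, H z = C := by
  have hloc' : ∀ z₀, ∃ g, AnalyticAt ℂ g z₀ ∧ H =ᶠ[𝓝[≠] z₀] g := by
    intro z₀
    obtain ⟨l, hl, g, hg, hHg⟩ := hloc z₀
    refine ⟨fun z ↦ g (z + l), hg.fun_comp_of_eq (f := fun z ↦ z + l) (by fun_prop) rfl, ?_⟩
    filter_upwards [hper l hl z₀, (tendsto_add_right_nhdsNE z₀ l).eventually hHg] with z h1 h2
    rw [← h1, h2]
  choose g hg hHg using hloc'
  -- The values of `H` at its removable singularities are arbitrary. The diagonal `z ↦ g z z`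
  -- replaces them by the limits of `H`, so it agrees near `z₀` with the single germ `g z₀` and is
  -- entire.
  have key : ∀ z₀, ∀ᶠ z in 𝓝 z₀, g z z = g z₀ z := by
    intro z₀
    have : ∀ᶠ z in 𝓝[≠] z₀, g z z = g z₀ z := by
      filter_upwards [eventually_nhdsNE_of_eventually_nhdsNE (hHg z₀),
        nhdsWithin_le_nhds (hg z₀).eventually_analyticAt] with z h1 h2
      exact tendsto_nhds_unique (tendsto_nhdsNE_of_eventuallyEq_analyticAt (hg z) (hHg z))
        (tendsto_nhdsNE_of_eventuallyEq_analyticAt h2 h1)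
    rw [eventually_nhdsWithin_iff] at this
    filter_upwards [this] with z hz
    by_cases h : z = z₀
    · rw [h]
    · exact hz h
  have hd : Differentiable ℂ fun z ↦ g z z := fun z₀ ↦
    (hg z₀).differentiableAt.congr_of_eventuallyEq (key z₀)
  have hp : ∀ z l, l ∈ Lam τ → g (z + l) (z + l) = g z z := by
    intro z l hl
    have h1 := (tendsto_nhdsNE_of_eventuallyEq_analyticAt (hg _) (hHg (z + l))).comp
      (tendsto_add_right_nhdsNE z l)
    exact tendsto_nhds_unique (h1.congr' (hper l hl z))
      (tendsto_nhdsNE_of_eventuallyEq_analyticAt (hg z) (hHg z))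
  refine ⟨g 0 0, fun z₀ ↦ ?_⟩
  filter_upwards [hHg z₀, nhdsWithin_le_nhds (key z₀)] with z h1 h2
  rw [h1, ← h2]
  -- A continuous periodic function for a full lattice has compact range, so Liouville's theorem
  -- applies.
  exact hd.apply_eq_apply_of_bounded (IsZLattice.isCompact_range_of_periodic
    (periods τ).lattice _ hd.continuous hp).isBounded z 0

lemma exists_eq_sub_mul {f : ℂ → ℂ} {z₀ : ℂ} (hf : AnalyticAt ℂ f z₀) (h0 : f z₀ = 0) :
    ∃ g, AnalyticAt ℂ g z₀ ∧ ∀ᶠ z in 𝓝 z₀, f z = (z - z₀) * g z := by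
  have h : ((1 : ℕ) : ℕ∞) ≤ analyticOrderAt f z₀ := by
    simpa [Order.one_le_iff_ne_zero] using hf.analyticOrderAt_ne_zero.mpr h0
  simpa using (natCast_le_analyticOrderAt hf).mp h

lemma exists_eq_sub_sq_mul {f : ℂ → ℂ} {z₀ : ℂ} (hf : AnalyticAt ℂ f z₀) (h0 : f z₀ = 0)
    (h1 : HasDerivAt f 0 z₀) :
    ∃ g, AnalyticAt ℂ g z₀ ∧ ∀ᶠ z in 𝓝 z₀, f z = (z - z₀) ^ 2 * g z := by
  obtain ⟨g, hg, hfg⟩ := exists_eq_sub_mul hf h0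
  have h2 : HasDerivAt f (g z₀) z₀ := by
    have := ((hasDerivAt_id z₀).sub_const z₀).mul hg.differentiableAt.hasDerivAt
    refine (this.congr_of_eventuallyEq hfg).congr_deriv ?_
    simp
  obtain ⟨k, hk, hgk⟩ := exists_eq_sub_mul hg (h2.unique h1)
  refine ⟨k, hk, ?_⟩
  filter_upwards [hfg, hgk] with z e1 e2
  rw [e1, e2]; ring

/-! ### The addition formula for the zeta function -/

/-- The difference of the two sides of the addition formula. -/
def additionDefect (a z : ℂ) : ℂ :=
  (wzeta τ (z - a) + wzeta τ a - wzeta τ z) * (wp τ z - wp τ a) - (wpDeriv τ z + wpDeriv τ a) / 2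

lemma additionDefect_comm (a z : ℂ) : additionDefect τ a z = additionDefect τ z a := by
  unfold additionDefect
  rw [← neg_sub z a, wzeta_neg]
  ring

lemma additionDefect_neg_neg (a z : ℂ) :
    additionDefect τ (-a) (-z) = -additionDefect τ a z := by
  unfold additionDefect
  rw [show -z - -a = -(z - a) by ring]
  simp only [wzeta_neg, wp_neg, wpDeriv_neg]
  ring

lemma neg_mem_Lam_iff {z : ℂ} : -z ∈ Lam τ ↔ z ∈ Lam τ := neg_mem_iff

lemma analyticAt_wzeta_sub {z a : ℂ} (hz : z - a ∉ Lam τ) :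
    AnalyticAt ℂ (fun z ↦ wzeta τ (z - a)) z :=
  (analyticAt_wzeta τ hz).fun_comp_of_eq (f := fun z ↦ z - a) (by fun_prop) rfl

lemma analyticAt_additionDefect {a z : ℂ} (hz : z ∉ Lam τ) (hza : z - a ∉ Lam τ) :
    AnalyticAt ℂ (additionDefect τ a) z := by
  have h1 := analyticAt_wzeta_sub τ hza
  have h2 := analyticAt_wzeta τ hz
  have h3 := analyticAt_wp τ hz
  have h4 := analyticAt_wpDeriv τ hz
  unfold additionDefect
  fun_prop

/-- As a function of `z` the defect is elliptic: the quasi-periods of `ζ(z - a)` and `ζ(z)` cancel.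
Its only possible poles, at `0` and `a` modulo the lattice, are removable. -/
lemma exists_additionDefect_eq {a : ℂ} (ha : a ∉ Lam τ) :
    ∃ C, ∀ z ∉ Lam τ, z - a ∉ Lam τ → additionDefect τ a z = C := by
  obtain ⟨s, p, q, hs, hp, hq, hs0, hs1, hp0, hζ, h℘, h℘'⟩ := exists_expansion_zero τ
  rsuffices ⟨C, hC⟩ : ∃ C, ∀ z₀, ∀ᶠ z in 𝓝[≠] z₀, additionDefect τ a z = C
  · refine ⟨C, fun z hz hza ↦ ?_⟩
    have h1 := tendsto_nhdsNE_of_eventuallyEq_analyticAt (analyticAt_additionDefect τ hz hza)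
      EventuallyEq.rfl
    exact tendsto_nhds_unique h1 (tendsto_const_nhds.congr' ((hC z).mono fun _ h ↦ h.symm))
  refine exists_eventually_eq_const τ ?_ ?_
  · intro l hl z₀
    obtain ⟨h, hh⟩ := exists_wzeta_add τ hl
    filter_upwards [eventually_notMem_Lam τ z₀, eventually_sub_notMem_Lam τ z₀ a] with z hz hza
    unfold additionDefect
    rw [show z + l - a = z - a + l by ring, hh _ hz, hh _ hza, wp_add τ hl, wpDeriv_add τ hl]
    ring
  · intro z₀
    by_cases hz : z₀ ∈ Lam τ
    · refine ⟨-z₀, neg_mem hz, ?_⟩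
      rw [add_neg_cancel]
      have hna : (0 : ℂ) - a ∉ Lam τ := by rwa [zero_sub, neg_mem_Lam_iff]
      have hZ : AnalyticAt ℂ (fun z ↦ wzeta τ (z - a) + wzeta τ a) 0 :=
        (analyticAt_wzeta_sub τ hna).add analyticAt_const
      have hZ' : HasDerivAt (fun z ↦ wzeta τ (z - a) + wzeta τ a) (-wp τ a) 0 := by
        have := ((hasDerivAt_wzeta τ hna).comp_sub_const 0 a).add_const (wzeta τ a)
        simpa using this
      -- After the `1 / z³` terms cancel, the polar part at `0` is this function divided by `z²`. It
      -- has a double zero because `ζ(z - a) + ζ(a)` vanishes at `0` with derivative `-℘(a)`.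
      obtain ⟨g, hg, hWg⟩ := exists_eq_sub_sq_mul (z₀ := 0)
        (f := fun z ↦ wzeta τ (z - a) + wzeta τ a - s z + z * (wp τ a - p z))
        (by fun_prop) (by simp [hs0]) (by
          have := (hZ'.sub hs1).add ((hasDerivAt_id (0 : ℂ)).mul
            (hp.differentiableAt.hasDerivAt.const_sub (wp τ a)))
          refine this.congr_deriv ?_
          simp [hp0])
      refine ⟨fun z ↦ g z + (wzeta τ (z - a) + wzeta τ a - s z) * (p z - wp τ a) - q z / 2 -
        wpDeriv τ a / 2, by fun_prop, ?_⟩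
      filter_upwards [nhdsWithin_le_nhds hWg, self_mem_nhdsWithin] with z hz hz0
      have hz0 : z ≠ 0 := hz0
      have hgz : g z = (wzeta τ (z - a) + wzeta τ a - s z + z * (wp τ a - p z)) / z ^ 2 := by
        rw [hz, sub_zero, mul_div_cancel_left₀ _ (pow_ne_zero 2 hz0)]
      rw [hgz, additionDefect, hζ z, h℘ z, h℘' z]
      field_simp
      ring
    · by_cases hza : z₀ - a ∈ Lam τ
      · refine ⟨-(z₀ - a), neg_mem hza, ?_⟩
        rw [show z₀ + -(z₀ - a) = a by ring]
        have h2 := analyticAt_wzeta τ ha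
        have h3 := analyticAt_wp τ ha
        have h4 := analyticAt_wpDeriv τ ha
        have h5 : AnalyticAt ℂ (fun z ↦ s (z - a)) a :=
          hs.fun_comp_of_eq (f := fun z ↦ z - a) (by fun_prop) (sub_self a)
        -- The zero of `℘(z) - ℘(a)` at `a` absorbs the simple pole of `ζ(z - a)`.
        obtain ⟨g, hg, hgz⟩ := exists_eq_sub_mul (f := fun z ↦ wp τ z - wp τ a) (z₀ := a)
          (by fun_prop) (sub_self _)
        refine ⟨fun z ↦ g z + (s (z - a) + wzeta τ a - wzeta τ z) * (wp τ z - wp τ a) -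
          (wpDeriv τ z + wpDeriv τ a) / 2,
          (hg.add (((h5.add analyticAt_const).sub h2).mul (h3.sub analyticAt_const))).sub
            ((h4.add analyticAt_const).div analyticAt_const two_ne_zero), ?_⟩
        filter_upwards [nhdsWithin_le_nhds hgz, self_mem_nhdsWithin] with z hz hz0
        have hz0 : z - a ≠ 0 := sub_ne_zero.mpr hz0
        have : g z = 1 / (z - a) * (wp τ z - wp τ a) := by
          rw [hz]; field_simp
        rw [this, additionDefect, hζ (z - a)]
        ring
      · exact ⟨0, zero_mem _, additionDefect τ a, by
          rw [add_zero]; exact analyticAt_additionDefect τ hz hza, EventuallyEq.rfl⟩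

theorem wzeta_addition {a z : ℂ} (ha : a ∉ Lam τ) (hz : z ∉ Lam τ) (hza : z - a ∉ Lam τ) :
    (wzeta τ (z - a) + wzeta τ a - wzeta τ z) * (wp τ z - wp τ a) =
      (wpDeriv τ z + wpDeriv τ a) / 2 := by
  rw [← sub_eq_zero]
  change additionDefect τ a z = 0
  -- The constant is found by symmetry alone. Joint oddness gives `C' = -C` for the constants
  -- attached to `-a` and `a`; exchanging the arguments at an auxiliary `w` identifies both with the
  -- constant `D` attached to `w`. Hence `C = C' = D = 0`.
  obtain ⟨w, hw, hwa, hwa'⟩ := ((eventually_notMem_Lam τ 0).and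
    ((eventually_sub_notMem_Lam τ 0 a).and (eventually_sub_notMem_Lam τ 0 (-a)))).exists
  have hna : -a ∉ Lam τ := by rwa [neg_mem_Lam_iff]
  obtain ⟨C, hC⟩ := exists_additionDefect_eq τ ha
  obtain ⟨C', hC'⟩ := exists_additionDefect_eq τ hna
  obtain ⟨D, hD⟩ := exists_additionDefect_eq τ hw
  have h1 := hC z hz hza
  have h2 := hC' (-z) (by rwa [neg_mem_Lam_iff])
    (by rwa [show -z - -a = -(z - a) by ring, neg_mem_Lam_iff])
  rw [additionDefect_neg_neg] at h2
  have h3 := hC w hw hwa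
  have h4 := hC' w hw hwa'
  rw [additionDefect_comm, hD a ha (by rwa [← neg_sub, neg_mem_Lam_iff])] at h3
  rw [additionDefect_comm, hD (-a) hna (by rwa [← neg_sub, neg_mem_Lam_iff])] at h4
  have : 2 * additionDefect τ a z = 0 := by linear_combination h1 - h2 + h4 - h3
  simpa using this

section

variable {a z : ℂ} (ha : a ∉ Lam τ) (hz : z ∉ Lam τ) (hza : z - a ∉ Lam τ) (hza' : z + a ∉ Lam τ)
include ha hz hza hza'

/-- Adding the addition formulas for `a` and `-a` keeps the part even in `a`, which is the
logarithmic derivative of `℘ - ℘(a)`; subtracting them, in the next lemma, keeps the odd part. -/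
lemma wzeta_sub_add_wzeta_add_mul :
    (wzeta τ (z - a) + wzeta τ (z + a) - 2 * wzeta τ z) * (wp τ z - wp τ a) = wpDeriv τ z := by
  have h1 := wzeta_addition τ ha hz hza
  have h2 := wzeta_addition τ (a := -a) (by rwa [neg_mem_Lam_iff]) hz (by rwa [sub_neg_eq_add])
  simp only [sub_neg_eq_add, wzeta_neg, wp_neg, wpDeriv_neg] at h2
  linear_combination h1 + h2

lemma wzeta_sub_sub_wzeta_add_mul :
    (wzeta τ (z - a) - wzeta τ (z + a) + 2 * wzeta τ a) * (wp τ z - wp τ a) = wpDeriv τ a := by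
  have h1 := wzeta_addition τ ha hz hza
  have h2 := wzeta_addition τ (a := -a) (by rwa [neg_mem_Lam_iff]) hz (by rwa [sub_neg_eq_add])
  simp only [sub_neg_eq_add, wzeta_neg, wp_neg, wpDeriv_neg] at h2
  linear_combination h1 - h2

end

/-! ### The values of `℘` -/

lemma tendsto_sq_mul_wp : Tendsto (fun z ↦ z ^ 2 * wp τ z) (𝓝[≠] 0) (𝓝 1) := by
  obtain ⟨s, p, q, hs, hp, hq, hs0, hs1, hp0, hζ, h℘, h℘'⟩ := exists_expansion_zero τ
  have := tendsto_nhdsNE_of_eventuallyEq_analyticAt (H := fun z ↦ z ^ 2 * wp τ z)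
    (g := fun z ↦ 1 + z ^ 2 * p z) (z₀ := 0) (by fun_prop) (by
      filter_upwards [self_mem_nhdsWithin] with z hz
      have hz : z ≠ 0 := hz
      rw [h℘]; field_simp)
  simpa using this

lemma tendsto_cube_mul_wpDeriv : Tendsto (fun z ↦ z ^ 3 * wpDeriv τ z) (𝓝[≠] 0) (𝓝 (-2)) := by
  obtain ⟨s, p, q, hs, hp, hq, hs0, hs1, hp0, hζ, h℘, h℘'⟩ := exists_expansion_zero τ
  have := tendsto_nhdsNE_of_eventuallyEq_analyticAt (H := fun z ↦ z ^ 3 * wpDeriv τ z)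
    (g := fun z ↦ -2 + z ^ 3 * q z) (z₀ := 0) (by fun_prop) (by
      filter_upwards [self_mem_nhdsWithin] with z hz
      have hz : z ≠ 0 := hz
      rw [h℘']; field_simp)
  simpa using this

lemma eventually_wpDeriv_ne_zero : ∀ᶠ z in 𝓝[≠] 0, wpDeriv τ z ≠ 0 := by
  filter_upwards [(tendsto_cube_mul_wpDeriv τ).eventually
    (eventually_ne_nhds (b := 0) (by norm_num))] with z hz h
  simp [h] at hz

lemma eventually_wp_ne (c : ℂ) : ∀ᶠ z in 𝓝[≠] 0, wp τ z ≠ c := by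
  have h0 : Tendsto (fun z : ℂ ↦ z ^ 2 * c) (𝓝[≠] 0) (𝓝 0) := by
    have : Tendsto (fun z : ℂ ↦ z ^ 2 * c) (𝓝 0) (𝓝 (0 ^ 2 * c)) :=
      Continuous.tendsto (by fun_prop) 0
    simpa using this.mono_left nhdsWithin_le_nhds
  have h1 := (tendsto_sq_mul_wp τ).sub h0
  filter_upwards [h1.eventually (eventually_ne_nhds (b := 0) (by norm_num))] with z hz h
  simp [h] at hz

/-- A polynomial that vanishes at `℘(z)` for all small `z ≠ 0` is zero. -/
lemma polynomial_eq_zero_of_eventually {S : Polynomial ℂ}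
    (h : ∀ᶠ z in 𝓝[≠] 0, S.eval (wp τ z) = 0) : S = 0 := by
  by_contra hS
  have h1 : ∀ᶠ z in 𝓝[≠] (0 : ℂ), ∀ c ∈ S.roots.toFinset, wp τ z ≠ c :=
    (Finset.eventually_all _).mpr fun c _ ↦ eventually_wp_ne τ c
  obtain ⟨z, hz1, hz2⟩ := (h.and h1).exists
  exact hz2 (wp τ z) (by simp [hS, hz1]) rfl

/-- `℘` is injective up to sign modulo `Λ_τ`. -/
theorem wp_ne_wp {a z : ℂ} (ha : a ∉ Lam τ) (hz : z ∉ Lam τ) (hza : z - a ∉ Lam τ)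
    (hza' : z + a ∉ Lam τ) : wp τ z ≠ wp τ a := by
  intro heq
  have hp : AnalyticAt ℂ (fun w ↦ wp τ w - wp τ a) z := (analyticAt_wp τ hz).sub analyticAt_const
  have hφ : AnalyticAt ℂ (fun w ↦ wzeta τ (w - a) + wzeta τ (w + a) - 2 * wzeta τ w) z := by
    have h1 := analyticAt_wzeta_sub τ hza
    have h2 := analyticAt_wzeta_sub τ (a := -a) (z := z) (by rwa [sub_neg_eq_add])
    have h3 := analyticAt_wzeta τ hz
    simp only [sub_neg_eq_add] at h2
    fun_prop
  have hopen := isOpen_compl_Lam τ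
  have hsh (b : ℂ) (hb : z + b ∉ Lam τ) : ∀ᶠ w in 𝓝 z, w + b ∉ Lam τ :=
    (hopen.preimage (continuous_add_const b)).mem_nhds hb
  -- If `℘(z) = ℘(a)`, then `℘ - ℘(a)` would divide its own derivative in the ring of germs at `z`.
  -- A zero of finite order cannot do this, since differentiation lowers the order by one; so `℘`
  -- would be constant, contradicting its pole at `0`.
  have hd : deriv (fun w ↦ wp τ w - wp τ a) =ᶠ[𝓝 z]
      (fun w ↦ wzeta τ (w - a) + wzeta τ (w + a) - 2 * wzeta τ w) *
        fun w ↦ wp τ w - wp τ a := by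
    filter_upwards [hopen.mem_nhds hz, hsh a hza', hsh (-a) (by rwa [← sub_eq_add_neg])]
      with w h1 h2 h3
    rw [← sub_eq_add_neg] at h3
    rw [((hasDerivAt_wp τ h1).sub_const _).deriv, Pi.mul_apply,
      wzeta_sub_add_wzeta_add_mul τ ha h1 h3 h2]
  have ho := hp.analyticOrderAt_deriv_add_one
  simp only [heq, sub_self, sub_zero] at ho
  rw [analyticOrderAt_congr hd, analyticOrderAt_mul hφ hp] at ho
  have htop : analyticOrderAt (fun w ↦ wp τ w - wp τ a) z = ⊤ := by
    by_contra hne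
    lift analyticOrderAt (fun w ↦ wp τ w - wp τ a) z to ℕ using hne with m hm
    have : ((m : ℕ∞) + 1) ≤ m := by
      calc ((m : ℕ∞) + 1) ≤ _ + (m : ℕ∞) + 1 := by gcongr; exact le_add_self
        _ = m := ho
    norm_cast at this
    omega
  have hz' := AnalyticOnNhd.eqOn_zero_of_preconnected_of_eventuallyEq_zero
    (f := fun w ↦ wp τ w - wp τ a) (U := (Lam τ : Set ℂ)ᶜ)
    (fun w hw ↦ (analyticAt_wp τ hw).sub analyticAt_const) (isPreconnected_compl_Lam τ)
    hz (analyticOrderAt_eq_top.mp htop)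
  obtain ⟨w, hw1, hw2⟩ := ((eventually_notMem_Lam τ 0).and (eventually_wp_ne τ (wp τ a))).exists
  exact hw2 (sub_eq_zero.mp (hz' hw1))

/-! ### Lagrange-type polynomials -/

section LagrangePolynomials

open Polynomial

variable {N : ℕ} (x c : Fin N → ℂ)

/-- `∏_i (X - x_i)`. -/
def nodePoly : ℂ[X] := ∏ i, (X - C (x i))

/-- `∏_{j ≠ i} (X - x_j)`. -/
def nodePolyErase (i : Fin N) : ℂ[X] := ∏ j ∈ Finset.univ.erase i, (X - C (x j))

/-- `∑_i c_i ∏_{j ≠ i} (X - x_j)`. -/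
def nodeSum : ℂ[X] := ∑ i, C (c i) * nodePolyErase x i

lemma mul_nodePolyErase (i : Fin N) : (X - C (x i)) * nodePolyErase x i = nodePoly x :=
  Finset.mul_prod_erase _ (fun i ↦ X - C (x i)) (Finset.mem_univ i)

lemma degree_nodePoly : (nodePoly x).degree = N := by
  simp [nodePoly, degree_prod]

lemma degree_nodeSum_lt : (nodeSum x c).degree < N := by
  refine (degree_sum_le _ _).trans_lt ((Finset.sup_lt_iff (WithBot.bot_lt_coe N)).2 fun i _ ↦ ?_)
  rw [← smul_eq_C_mul]
  refine (degree_smul_le _ _).trans_lt ?_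
  have h : (nodePolyErase x i).degree < ((X - C (x i)) * nodePolyErase x i).degree := by
    have h0 : (nodePolyErase x i).Monic := monic_prod_X_sub_C _ _
    rw [degree_mul, degree_X_sub_C, degree_eq_natDegree h0.ne_zero]
    norm_cast
    omega
  rwa [mul_nodePolyErase, degree_nodePoly] at h

/-- Dividing by `∏ (X - x_i)` gives one step of the expansion of `∑ c_i / (X - x_i)` at infinity:
the first moment splits off and the weights become `c_i x_i`. -/
lemma X_mul_nodeSum : X * nodeSum x c =
    C (∑ i, c i) * nodePoly x + nodeSum x (fun i ↦ c i * x i) := by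
  simp only [nodeSum, Finset.mul_sum, map_sum, Finset.sum_mul, ← Finset.sum_add_distrib]
  refine Finset.sum_congr rfl fun i _ ↦ ?_
  rw [← mul_nodePolyErase x i, map_mul]
  ring

/-- The analogous step of the expansion at a point `e` that is not a node: the weights become `c_i /
(x_i - e)`. -/
lemma nodeSum_eq_sub {e : ℂ} (he : ∀ i, x i ≠ e) : nodeSum x c =
    (X - C e) * nodeSum x (fun i ↦ c i / (x i - e)) - C (∑ i, c i / (x i - e)) * nodePoly x := by
  simp only [nodeSum, Finset.mul_sum, map_sum, Finset.sum_mul, ← Finset.sum_sub_distrib]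
  refine Finset.sum_congr rfl fun i _ ↦ ?_
  rw [← mul_nodePolyErase x i]
  have h : C (c i) = C (c i / (x i - e)) * (C (x i) - C e) := by
    rw [← map_sub, ← map_mul, div_mul_cancel₀ _ (sub_ne_zero.mpr (he i))]
  rw [h]
  ring

/-- Each lowering of the degree bound by one costs exactly one vanishing moment, through
`X_mul_nodeSum`. With `degree` rather than `natDegree` the zero polynomial needs no exception. -/
lemma degree_nodeSum_iff (m : ℕ) (hm : m ≤ N) : (nodeSum x c).degree < ((N - m : ℕ) : WithBot ℕ) ↔
    ∀ l < m, ∑ i, c i * x i ^ l = 0 := by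
  induction m generalizing c with
  | zero => simpa using degree_nodeSum_lt x c
  | succ m ih =>
    have h1 : (nodeSum x c).degree < ((N - (m + 1) : ℕ) : WithBot ℕ) ↔
        ∑ i, c i = 0 ∧ (nodeSum x fun i ↦ c i * x i).degree < ((N - m : ℕ) : WithBot ℕ) := by
      have hX : (nodeSum x c).degree < ((N - (m + 1) : ℕ) : WithBot ℕ) ↔
          (X * nodeSum x c).degree < ((N - m : ℕ) : WithBot ℕ) := by
        by_cases h0 : nodeSum x c = 0
        · simp [h0]
        · rw [degree_mul, degree_X, degree_eq_natDegree h0]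
          norm_cast
          omega
      rw [hX, X_mul_nodeSum]
      constructor
      · intro h
        have h0 : ∑ i, c i = 0 := by
          by_contra h0
          have hd : (C (∑ i, c i) * nodePoly x).degree = N := by
            rw [degree_C_mul h0, degree_nodePoly]
          rw [degree_add_eq_left_of_degree_lt (by rw [hd]; exact degree_nodeSum_lt _ _), hd] at h
          norm_cast at h
          omega
        exact ⟨h0, by simpa [h0] using h⟩
      · rintro ⟨h0, h⟩
        simpa [h0] using h
    rw [h1, ih _ (by omega)]
    constructor
    · rintro ⟨h0, h⟩ l hl
      cases l with
      | zero => simpa using h0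
      | succ l =>
        rw [← h l (by omega)]
        exact Finset.sum_congr rfl fun i _ ↦ by ring
    · intro h
      refine ⟨by simpa using h 0 (by omega), fun l hl ↦ ?_⟩
      rw [← h (l + 1) (by omega)]
      exact Finset.sum_congr rfl fun i _ ↦ by ring

/-- Since `∏ (X - x_i)` does not vanish at `e`, each further factor `X - e` costs exactly one
vanishing negative moment, through `nodeSum_eq_sub`. -/
lemma X_sub_C_pow_dvd_nodeSum_iff {e : ℂ} (he : ∀ i, x i ≠ e) (m : ℕ) :
    (X - C e) ^ m ∣ nodeSum x c ↔ ∀ l, 1 ≤ l → l ≤ m → ∑ i, c i / (x i - e) ^ l = 0 := by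
  have hQ : (nodePoly x).eval e ≠ 0 := by
    rw [nodePoly, eval_prod]
    exact Finset.prod_ne_zero_iff.mpr fun i _ ↦ by simpa using sub_ne_zero.mpr (he i).symm
  induction m generalizing c with
  | zero =>
    simp only [pow_zero, isUnit_one, IsUnit.dvd, true_iff]
    intro l h1 h2
    omega
  | succ m ih =>
    have h1 : (X - C e) ^ (m + 1) ∣ nodeSum x c ↔
        ∑ i, c i / (x i - e) = 0 ∧ (X - C e) ^ m ∣ nodeSum x (fun i ↦ c i / (x i - e)) := by
      rw [nodeSum_eq_sub x c he]
      constructor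
      · intro h
        have h0 : ∑ i, c i / (x i - e) = 0 := by
          have := dvd_iff_isRoot.mp ((dvd_pow_self (X - C e) (Nat.succ_ne_zero m)).trans h)
          simpa only [IsRoot, eval_sub, eval_mul, eval_X, eval_C, sub_self, zero_mul, zero_sub,
            neg_eq_zero, mul_eq_zero, hQ, or_false] using this
        refine ⟨h0, ?_⟩
        rw [h0, map_zero, zero_mul, sub_zero, pow_succ'] at h
        exact (mul_dvd_mul_iff_left (X_sub_C_ne_zero e)).mp h
      · rintro ⟨h0, h⟩
        rw [h0, map_zero, zero_mul, sub_zero, pow_succ']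
        exact mul_dvd_mul_left _ h
    refine h1.trans ((and_congr_right fun _ ↦ ih _).trans ?_)
    constructor
    · rintro ⟨h0, h⟩ l hl1 hl2
      obtain ⟨l, rfl⟩ := Nat.exists_eq_add_of_le' hl1
      rcases Nat.eq_zero_or_pos l with rfl | hl
      · simpa using h0
      · rw [← h l hl (by omega)]
        exact Finset.sum_congr rfl fun i _ ↦ by rw [div_div, pow_succ']
    · intro h
      refine ⟨by simpa using h 1 le_rfl (by omega), fun l hl1 hl2 ↦ ?_⟩
      rw [← h (l + 1) (by omega) (by omega)]
      exact Finset.sum_congr rfl fun i _ ↦ by rw [div_div, pow_succ']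

lemma sum_mul_prod_erase_pow {e : ℂ} (he : ∀ i, x i ≠ e) (l : ℕ) :
    ∑ i, c i * ∏ j ∈ Finset.univ.erase i, (x j - e) ^ l =
      (∏ j, (x j - e) ^ l) * ∑ i, c i / (x i - e) ^ l := by
  rw [Finset.mul_sum]
  refine Finset.sum_congr rfl fun i _ ↦ ?_
  rw [← Finset.mul_prod_erase _ _ (Finset.mem_univ i)]
  have := pow_ne_zero l (sub_ne_zero.mpr (he i))
  field_simp

lemma natDegree_eq_of_wronskian_eq_zero {P R : ℂ[X]} (hP : P ≠ 0) (hR : R ≠ 0)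
    (h : derivative P * R = P * derivative R) : P.natDegree = R.natDegree := by
  by_cases hp : P.natDegree = 0
  · have h1 : derivative P = 0 := derivative_of_natDegree_zero hp
    rw [h1, zero_mul, eq_comm, mul_eq_zero, or_iff_right hP] at h
    rw [hp, derivative_eq_zero.mp h]
  by_cases hr : R.natDegree = 0
  · have h1 : derivative R = 0 := derivative_of_natDegree_zero hr
    rw [h1, mul_zero, mul_eq_zero, or_iff_left hR] at h
    rw [hr, derivative_eq_zero.mp h]
  obtain ⟨p, hp⟩ := Nat.exists_eq_succ_of_ne_zero hp
  obtain ⟨r, hr⟩ := Nat.exists_eq_succ_of_ne_zero hr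
  rw [Nat.succ_eq_add_one] at hp hr
  -- The two products have the same formal top degree, and there their coefficients are the product
  -- of the leading coefficients times `deg P` and `deg R` respectively.
  have e1 : (derivative P * R).coeff (p + (r + 1)) = P.leadingCoeff * (p + 1) * R.leadingCoeff := by
    rw [coeff_mul_add_eq_of_natDegree_le ((natDegree_derivative_le P).trans (by omega)) hr.le,
      coeff_derivative, leadingCoeff, leadingCoeff, hp, hr]
  have e2 : (P * derivative R).coeff (p + 1 + r) =
      P.leadingCoeff * (R.leadingCoeff * (r + 1)) := by
    rw [coeff_mul_add_eq_of_natDegree_le hp.le ((natDegree_derivative_le R).trans (by omega)),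
      coeff_derivative, leadingCoeff, leadingCoeff, hp, hr]
  rw [h, show p + (r + 1) = p + 1 + r by omega, e2] at e1
  have hP' := leadingCoeff_ne_zero.mpr hP
  have hR' := leadingCoeff_ne_zero.mpr hR
  have e3 : P.leadingCoeff * R.leadingCoeff * ((r : ℂ) - p) = 0 := by linear_combination e1
  have e4 : (r : ℂ) = p := by
    simpa [hP, hR, sub_eq_zero] using e3
  have : r = p := by exact_mod_cast e4
  omega

/-- Two polynomials with vanishing Wronskian are proportional. -/
lemma exists_eq_C_mul_of_wronskian_eq_zero {P R : ℂ[X]} (hR : R.Monic)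
    (h : derivative P * R = P * derivative R) : ∃ a, P = C a * R := by
  refine ⟨P.coeff R.natDegree, ?_⟩
  by_contra hne
  -- The subtracted multiple kills the coefficient in degree `deg R` and leaves the Wronskian zero.
  -- A nonzero difference would have degree exactly `deg R`, where its coefficient is zero.
  have hS : P - C (P.coeff R.natDegree) * R ≠ 0 := sub_ne_zero.mpr hne
  have hdeg := natDegree_eq_of_wronskian_eq_zero hS hR.ne_zero (by
    simp only [derivative_sub, derivative_C_mul]
    linear_combination h)
  have h1 : (P - C (P.coeff R.natDegree) * R).leadingCoeff = 0 := by
    rw [leadingCoeff, hdeg]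
    simp [hR.coeff_natDegree]
  exact hS (leadingCoeff_eq_zero.mp h1)

end LagrangePolynomials

/-! ### Half periods -/

lemma mem_Lam {z : ℂ} : z ∈ Lam τ ↔ ∃ p q : ℤ, (p : ℂ) + q * τ = z := by
  have := PeriodPair.mem_lattice (L := periods τ) (x := z)
  simpa [Lam, periods] using this

lemma omega_mem_Lam (k : Fin 4) : omega τ k ∈ Lam τ := by
  rw [mem_Lam]
  fin_cases k
  · exact ⟨0, 0, by simp [omega]⟩
  · exact ⟨1, 0, by simp [omega]⟩
  · exact ⟨0, 1, by simp [omega]⟩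
  · exact ⟨1, 1, by simp [omega]⟩

lemma mem_twoTorsion_iff {z : ℂ} : z ∈ twoTorsion τ ↔ 2 * z ∈ Lam τ := by
  constructor
  · rintro ⟨k, hk⟩
    have := add_mem (add_mem hk hk) (omega_mem_Lam τ k)
    convert this using 1
    ring
  · intro h
    obtain ⟨p, q, hpq⟩ := (mem_Lam τ).mp h
    have hz : z = ((p : ℂ) + q * τ) / 2 := by rw [hpq]; ring
    rcases Int.even_or_odd' p with ⟨p', hp | hp⟩ <;> rcases Int.even_or_odd' q with ⟨q', hq | hq⟩
    · exact ⟨0, (mem_Lam τ).mpr ⟨p', q', by rw [hz, hp, hq]; simp [omega]; ring⟩⟩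
    · exact ⟨2, (mem_Lam τ).mpr ⟨p', q', by rw [hz, hp, hq]; simp [omega]; ring⟩⟩
    · exact ⟨1, (mem_Lam τ).mpr ⟨p', q', by rw [hz, hp, hq]; simp [omega]; ring⟩⟩
    · exact ⟨3, (mem_Lam τ).mpr ⟨p', q', by rw [hz, hp, hq]; simp [omega]; ring⟩⟩

lemma half_omega_sub_notMem_Lam {j k : Fin 4} (h : j ≠ k) :
    omega τ j / 2 - omega τ k / 2 ∉ Lam τ := by
  intro hmem
  obtain ⟨p, q, hpq⟩ := (mem_Lam τ).mp hmem
  have hdig (k : Fin 4) : omega τ k =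
      ((![0, 1, 0, 1] k : ℤ) : ℂ) + ((![0, 0, 1, 1] k : ℤ) : ℂ) * τ := by
    fin_cases k <;> simp [omega]
  -- The coordinates of the `ω_k` in the basis `(1, τ)` represent the four classes modulo `2`, so no
  -- two of them have both differences even.
  have hpar : ∀ j k : Fin 4, j ≠ k → ¬ ((2 : ℤ) ∣ ![0, 1, 0, 1] j - ![0, 1, 0, 1] k ∧
      (2 : ℤ) ∣ ![0, 0, 1, 1] j - ![0, 0, 1, 1] k) := by decide
  have hjk := hpar j k h
  rw [hdig j, hdig k] at hpq
  generalize (![0, 1, 0, 1] j : ℤ) = u at *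
  generalize (![0, 1, 0, 1] k : ℤ) = u' at *
  generalize (![0, 0, 1, 1] j : ℤ) = v at *
  generalize (![0, 0, 1, 1] k : ℤ) = v' at *
  have e : (((u - u' - 2 * p : ℤ) : ℂ)) + ((v - v' - 2 * q : ℤ) : ℂ) * τ = 0 := by
    push_cast
    linear_combination (-2) * hpq
  have hv0 : ((v - v' - 2 * q : ℤ) : ℝ) = 0 := by
    have := congrArg Complex.im e
    rw [Complex.add_im, Complex.intCast_im, zero_add, ← zsmul_eq_mul, Complex.smul_im,
      Complex.zero_im, zsmul_eq_mul, mul_eq_zero] at this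
    exact this.resolve_right τ.im_ne_zero
  have hv1 : v - v' - 2 * q = 0 := by exact_mod_cast hv0
  rw [hv1, Int.cast_zero, zero_mul, add_zero] at e
  have hu1 : u - u' - 2 * p = 0 := by exact_mod_cast e
  exact hjk ⟨⟨p, by omega⟩, ⟨q, by omega⟩⟩

lemma sub_half_omega_notMem {z : ℂ} (hz : 2 * z ∉ Lam τ) (k : Fin 4) :
    z - omega τ k / 2 ∉ Lam τ := fun h ↦ hz ((mem_twoTorsion_iff τ).mp ⟨k, h⟩)

lemma add_half_omega_notMem {z : ℂ} (hz : 2 * z ∉ Lam τ) (k : Fin 4) :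
    z + omega τ k / 2 ∉ Lam τ := by
  have := sub_half_omega_notMem τ hz k
  rw [← add_mem_Lam_iff τ (omega_mem_Lam τ k)] at this
  convert this using 2
  ring

lemma notMem_Lam_of_two_mul {z : ℂ} (hz : 2 * z ∉ Lam τ) : z ∉ Lam τ := fun h ↦ hz (by
  rw [two_mul]; exact add_mem h h)

lemma wp_add_half_omega (z : ℂ) (k : Fin 4) :
    wp τ (z + omega τ k / 2) = wp τ (z - omega τ k / 2) := by
  rw [← wp_add τ (omega_mem_Lam τ k) (z - omega τ k / 2)]
  congr 1; ring

lemma wpDeriv_half_omega {k : Fin 4} : wpDeriv τ (omega τ k / 2) = 0 := by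
  have h := wpDeriv_add τ (omega_mem_Lam τ k) (-(omega τ k / 2))
  rw [wpDeriv_neg, show -(omega τ k / 2) + omega τ k = omega τ k / 2 by ring] at h
  exact CharZero.eq_neg_self_iff.mp h

lemma half_omega_notMem_Lam {k : Fin 4} (hk : k ≠ 0) : omega τ k / 2 ∉ Lam τ := by
  simpa [omega] using half_omega_sub_notMem_Lam τ hk

lemma two_mul_half_omega (k : Fin 4) : 2 * (omega τ k / 2) ∈ Lam τ := by
  rw [mul_div_cancel₀ _ (two_ne_zero' ℂ)]; exact omega_mem_Lam τ k

lemma e_injOn {j k : Fin 4} (hj : j ≠ 0) (hk : k ≠ 0) (h : j ≠ k) : e τ j ≠ e τ k := by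
  refine wp_ne_wp τ (half_omega_notMem_Lam τ hk) (half_omega_notMem_Lam τ hj)
    (half_omega_sub_notMem_Lam τ h) fun h' ↦ half_omega_sub_notMem_Lam τ h ?_
  rw [← add_mem_Lam_iff τ (omega_mem_Lam τ k)]
  convert h' using 1; ring

/-! ### The logarithmic derivative of the ansatz -/

section LogDeriv

variable (n : Fin 4 → ℕ) {N : ℕ} (a : Fin N → ℂ) (c : ℂ)

/-- The complement of the classes of `± a_i` and of the two-torsion points. -/
def genericSet : Set ℂ := {z | 2 * z ∉ Lam τ ∧ ∀ i, z - a i ∉ Lam τ ∧ z + a i ∉ Lam τ}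

/-- The logarithmic derivative of the ansatz. -/
def logAnsatz (z : ℂ) : ℂ :=
  c + ∑ i, wzeta τ (z - a i) - ∑ k, (n k : ℂ) * wzeta τ (z - omega τ k / 2)

/-- The derivative of `logAnsatz`. -/
def logAnsatzDeriv (z : ℂ) : ℂ :=
  -∑ i, wp τ (z - a i) + ∑ k, (n k : ℂ) * wp τ (z - omega τ k / 2)

/-- The quotient `y'' / y` for the ansatz `y`. -/
def riccati (z : ℂ) : ℂ := logAnsatzDeriv τ n a z + logAnsatz τ n a c z ^ 2

variable {n a}

lemma isOpen_genericSet : IsOpen (genericSet τ a) := by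
  have h := isOpen_compl_Lam τ
  have : genericSet τ a = (fun z ↦ 2 * z) ⁻¹' (Lam τ : Set ℂ)ᶜ ∩
      ⋂ i, ((fun z ↦ z - a i) ⁻¹' (Lam τ : Set ℂ)ᶜ ∩ (fun z ↦ z + a i) ⁻¹' (Lam τ : Set ℂ)ᶜ) := by
    ext z; simp [genericSet]
  rw [this]
  exact (h.preimage (by fun_prop)).inter (isOpen_iInter_of_finite fun i ↦
    (h.preimage (by fun_prop)).inter (h.preimage (by fun_prop)))

lemma eventually_mem_genericSet (z₀ : ℂ) : ∀ᶠ z in 𝓝[≠] z₀, z ∈ genericSet τ a := by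
  have h1 : ∀ᶠ z in 𝓝[≠] z₀, ∀ k : Fin 4, z - omega τ k / 2 ∉ Lam τ :=
    eventually_all.mpr fun k ↦ eventually_sub_notMem_Lam τ z₀ _
  have h2 : ∀ᶠ z in 𝓝[≠] z₀, ∀ i, z - a i ∉ Lam τ :=
    eventually_all.mpr fun i ↦ eventually_sub_notMem_Lam τ z₀ _
  have h3 : ∀ᶠ z in 𝓝[≠] z₀, ∀ i, z - -a i ∉ Lam τ :=
    eventually_all.mpr fun i ↦ eventually_sub_notMem_Lam τ z₀ _
  filter_upwards [h1, h2, h3] with z h1 h2 h3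
  refine ⟨fun h ↦ ?_, fun i ↦ ⟨h2 i, by simpa using h3 i⟩⟩
  obtain ⟨k, hk⟩ := (mem_twoTorsion_iff τ).mpr h
  exact h1 k hk

lemma neg_mem_genericSet {z : ℂ} (hz : z ∈ genericSet τ a) : -z ∈ genericSet τ a := by
  refine ⟨?_, fun i ↦ ⟨?_, ?_⟩⟩
  · rw [mul_neg, neg_mem_Lam_iff]; exact hz.1
  · rw [show -z - a i = -(z + a i) by ring, neg_mem_Lam_iff]; exact (hz.2 i).2
  · rw [show -z + a i = -(z - a i) by ring, neg_mem_Lam_iff]; exact (hz.2 i).1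

lemma hasDerivAt_logAnsatz {z : ℂ} (hz : z ∈ genericSet τ a) :
    HasDerivAt (logAnsatz τ n a c) (logAnsatzDeriv τ n a z) z := by
  have h1 : HasDerivAt (fun z ↦ ∑ i, wzeta τ (z - a i)) (∑ i, -wp τ (z - a i)) z :=
    HasDerivAt.fun_sum fun i _ ↦ (hasDerivAt_wzeta τ (hz.2 i).1).comp_sub_const z (a i)
  have h2 : HasDerivAt (fun z ↦ ∑ k, (n k : ℂ) * wzeta τ (z - omega τ k / 2))
      (∑ k, (n k : ℂ) * -wp τ (z - omega τ k / 2)) z :=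
    HasDerivAt.fun_sum fun k _ ↦ ((hasDerivAt_wzeta τ
      (sub_half_omega_notMem τ hz.1 k)).comp_sub_const z _).const_mul _
  refine ((h1.const_add c).sub h2).congr_deriv ?_
  simp only [logAnsatzDeriv, Finset.sum_neg_distrib, mul_neg]
  ring

lemma ansatz_ne_zero {z : ℂ} (hz : z ∈ genericSet τ a) : ansatz n τ a c z ≠ 0 :=
  div_ne_zero (mul_ne_zero (Complex.exp_ne_zero _) (Finset.prod_ne_zero_iff.mpr fun i _ ↦
    wsigma_ne_zero τ (hz.2 i).1)) (Finset.prod_ne_zero_iff.mpr fun k _ ↦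
    pow_ne_zero _ (wsigma_ne_zero τ (sub_half_omega_notMem τ hz.1 k)))

lemma differentiableAt_wsigma_sub (z b : ℂ) : DifferentiableAt ℂ (fun z ↦ wsigma τ (z - b)) z :=
  ((differentiable_wsigma τ).comp (differentiable_id.sub_const b)) z

lemma differentiableAt_ansatz {z : ℂ} (hz : z ∈ regularSet n τ) :
    DifferentiableAt ℂ (ansatz n τ a c) z := by
  refine DifferentiableAt.fun_div (.fun_mul (by fun_prop)
    (.fun_finsetProd fun i _ ↦ differentiableAt_wsigma_sub τ z _))
    (.fun_finsetProd fun k _ ↦ (differentiableAt_wsigma_sub τ z _).fun_pow _) ?_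
  refine Finset.prod_ne_zero_iff.mpr fun k _ ↦ ?_
  by_cases hk : n k = 0
  · simp [hk]
  · exact pow_ne_zero _ (wsigma_ne_zero τ (hz k hk))

lemma genericSet_subset_regularSet : genericSet τ a ⊆ regularSet n τ :=
  fun _ hz k _ ↦ sub_half_omega_notMem τ hz.1 k

lemma logDeriv_wsigma_sub {z b : ℂ} (h : z - b ∉ Lam τ) :
    logDeriv (fun z ↦ wsigma τ (z - b)) z = wzeta τ (z - b) := by
  rw [logDeriv_apply, ((hasDerivAt_wsigma τ h).comp_sub_const z b).deriv,
    mul_div_cancel_right₀ _ (wsigma_ne_zero τ h)]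

lemma logDeriv_ansatz {z : ℂ} (hz : z ∈ genericSet τ a) :
    logDeriv (ansatz n τ a c) z = logAnsatz τ n a c z := by
  have h1 : ∀ i, wsigma τ (z - a i) ≠ 0 := fun i ↦ wsigma_ne_zero τ (hz.2 i).1
  have h2 : ∀ k, wsigma τ (z - omega τ k / 2) ≠ 0 := fun k ↦
    wsigma_ne_zero τ (sub_half_omega_notMem τ hz.1 k)
  have hd1 : DifferentiableAt ℂ (fun z ↦ ∏ i, wsigma τ (z - a i)) z :=
    .fun_finsetProd fun i _ ↦ differentiableAt_wsigma_sub τ z _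
  have hd2 : DifferentiableAt ℂ (fun z ↦ ∏ k, wsigma τ (z - omega τ k / 2) ^ n k) z :=
    .fun_finsetProd fun k _ ↦ (differentiableAt_wsigma_sub τ z _).fun_pow _
  have h1' := Finset.prod_ne_zero_iff.mpr fun i (_ : i ∈ Finset.univ) ↦ h1 i
  have h2' := Finset.prod_ne_zero_iff.mpr fun k (_ : k ∈ Finset.univ) ↦
    pow_ne_zero (n k) (h2 k)
  have e0 : logDeriv (fun z ↦ Complex.exp (c * z)) z = c := by
    have : HasDerivAt (fun z ↦ Complex.exp (c * z)) (Complex.exp (c * z) * c) z := by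
      simpa using ((hasDerivAt_id z).const_mul c).cexp
    rw [logDeriv_apply, this.deriv, mul_div_cancel_left₀ _ (Complex.exp_ne_zero _)]
  have e1 : logDeriv (fun z ↦ ∏ i, wsigma τ (z - a i)) z = ∑ i, wzeta τ (z - a i) := by
    rw [logDeriv_prod (fun i _ ↦ h1 i) (fun i _ ↦ differentiableAt_wsigma_sub τ z _)]
    exact Finset.sum_congr rfl fun i _ ↦ logDeriv_wsigma_sub τ (hz.2 i).1
  have e2 : logDeriv (fun z ↦ ∏ k, wsigma τ (z - omega τ k / 2) ^ n k) z =
      ∑ k, (n k : ℂ) * wzeta τ (z - omega τ k / 2) := by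
    rw [logDeriv_prod (f := fun k z ↦ wsigma τ (z - omega τ k / 2) ^ n k)
      (fun k _ ↦ pow_ne_zero _ (h2 k))
      (fun k _ ↦ (differentiableAt_wsigma_sub τ z _).fun_pow _)]
    refine Finset.sum_congr rfl fun k _ ↦ ?_
    rw [logDeriv_fun_pow (differentiableAt_wsigma_sub τ z _),
      logDeriv_wsigma_sub τ (sub_half_omega_notMem τ hz.1 k)]
  change logDeriv (fun z ↦ Complex.exp (c * z) * (∏ i, wsigma τ (z - a i)) /
    ∏ k, wsigma τ (z - omega τ k / 2) ^ n k) z = _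
  have hde : DifferentiableAt ℂ (fun z ↦ Complex.exp (c * z)) z := by fun_prop
  rw [logDeriv_div (f := fun z ↦ Complex.exp (c * z) * ∏ i, wsigma τ (z - a i)) z
      (mul_ne_zero (Complex.exp_ne_zero _) h1') h2' (hde.fun_mul hd1) hd2,
    logDeriv_mul (f := fun z ↦ Complex.exp (c * z)) z (Complex.exp_ne_zero _) h1' hde hd1,
    e0, e1, e2, logAnsatz]

lemma deriv_ansatz {z : ℂ} (hz : z ∈ genericSet τ a) :
    deriv (ansatz n τ a c) z = logAnsatz τ n a c z * ansatz n τ a c z := by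
  rw [← logDeriv_ansatz τ c hz, logDeriv_apply, div_mul_cancel₀ _ (ansatz_ne_zero τ c hz)]

lemma deriv_deriv_ansatz {z : ℂ} (hz : z ∈ genericSet τ a) :
    deriv (deriv (ansatz n τ a c)) z = riccati τ n a c z * ansatz n τ a c z := by
  have h : deriv (ansatz n τ a c) =ᶠ[𝓝 z] fun z ↦ logAnsatz τ n a c z * ansatz n τ a c z := by
    filter_upwards [(isOpen_genericSet τ).mem_nhds hz] with w hw using deriv_ansatz τ c hw
  have hy := (differentiableAt_ansatz τ c
    (genericSet_subset_regularSet (n := n) τ hz)).hasDerivAt (f := ansatz n τ a c)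
  rw [h.deriv_eq, ((hasDerivAt_logAnsatz τ c hz).fun_mul hy).deriv, deriv_ansatz τ c hz, riccati]
  ring

lemma potential_eq (B z : ℂ) : potential n B τ z =
    (∑ k, (n k : ℂ) * ((n k : ℂ) + 1) * wp τ (z - omega τ k / 2)) + B := by
  simp only [potential, wp_add_half_omega]

lemma isOpen_regularSet : IsOpen (regularSet n τ) := by
  have h := isOpen_compl_Lam τ
  have : regularSet n τ = ⋂ k, {z | n k ≠ 0 → z - omega τ k / 2 ∉ Lam τ} := by
    ext z; simp [regularSet]
  rw [this]
  refine isOpen_iInter_of_finite fun k ↦ ?_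
  by_cases hk : n k = 0
  · simp [hk]
  · convert h.preimage (f := fun z ↦ z - omega τ k / 2) (by fun_prop) using 1
    ext z
    simp [hk]

lemma analyticAt_wp_sub {z b : ℂ} (hz : z - b ∉ Lam τ) :
    AnalyticAt ℂ (fun z ↦ wp τ (z - b)) z :=
  (analyticAt_wp τ hz).fun_comp_of_eq (f := fun z ↦ z - b) (by fun_prop) rfl

lemma analyticAt_potential (B : ℂ) {z : ℂ} (hz : z ∈ regularSet n τ) :
    AnalyticAt ℂ (potential n B τ) z := by
  rw [funext (potential_eq τ (n := n) B)]
  refine .fun_add (Finset.analyticAt_fun_sum _ fun k _ ↦ ?_) analyticAt_const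
  by_cases hk : n k = 0
  · simpa [hk] using analyticAt_const
  · exact analyticAt_const.fun_mul (analyticAt_wp_sub τ (hz k hk))

/-- On the generic set `y` has no zero and can be cancelled. The remaining regular points, such as
the `± a_i`, are isolated exceptions where the equation follows by continuity of both sides. -/
theorem isSolution_ansatz_iff (B : ℂ) : IsSolution n B τ (ansatz n τ a c) ↔
    ∀ z ∈ genericSet τ a, riccati τ n a c z = potential n B τ z := by
  constructor
  · rintro ⟨-, h⟩ z hz
    have h1 := h z (genericSet_subset_regularSet τ hz)
    rw [deriv_deriv_ansatz τ c hz] at h1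
    exact mul_right_cancel₀ (ansatz_ne_zero τ c hz) h1
  · intro h
    have hd : DifferentiableOn ℂ (ansatz n τ a c) (regularSet n τ) :=
      fun z hz ↦ (differentiableAt_ansatz τ c hz).differentiableWithinAt
    refine ⟨hd, fun z hz ↦ ?_⟩
    have hy : AnalyticAt ℂ (ansatz n τ a c) z :=
      hd.analyticAt ((isOpen_regularSet τ).mem_nhds hz)
    have t1 : Tendsto (deriv (deriv (ansatz n τ a c))) (𝓝[≠] z) _ :=
      hy.deriv.deriv.continuousAt.tendsto.mono_left nhdsWithin_le_nhds
    have t2 := ((analyticAt_potential τ B hz).fun_mul hy).continuousAt.tendsto.mono_left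
      (nhdsWithin_le_nhds (s := {z}ᶜ))
    refine tendsto_nhds_unique t1 (t2.congr' ?_)
    filter_upwards [eventually_mem_genericSet τ z] with w hw
    rw [deriv_deriv_ansatz τ c hw, h w hw]

/-- The residue of `y'' / y - I_n` at a half period. -/
lemma exists_residue (B : ℂ) (k : Fin 4) (ha : ∀ i, a i ∉ twoTorsion τ) :
    ∃ m : ℂ → ℂ, AnalyticAt ℂ m (omega τ k / 2) ∧
      m (omega τ k / 2) = -2 * n k * (c + ∑ i, wzeta τ (omega τ k / 2 - a i) -
        ∑ l ∈ Finset.univ.erase k, (n l : ℂ) * wzeta τ (omega τ k / 2 - omega τ l / 2)) ∧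
      ∀ᶠ z in 𝓝[≠] (omega τ k / 2),
        (z - omega τ k / 2) * (riccati τ n a c z - potential n B τ z) = m z := by
  obtain ⟨s, p, q, hs, hp, hq, hs0, hs1, hp0, hζ, h℘, h℘'⟩ := exists_expansion_zero τ
  set w := omega τ k / 2 with hw
  have ha' : ∀ i, w - a i ∉ Lam τ := fun i h ↦ ha i ⟨k, by
    rwa [← neg_mem_Lam_iff, neg_sub]⟩
  have ho : ∀ l ∈ Finset.univ.erase k, w - omega τ l / 2 ∉ Lam τ := fun l hl ↦
    half_omega_sub_notMem_Lam τ (Finset.ne_of_mem_erase hl).symm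
  have hs' : AnalyticAt ℂ (fun z ↦ s (z - w)) w :=
    hs.fun_comp_of_eq (f := fun z ↦ z - w) (by fun_prop) (sub_self w)
  have hp' : AnalyticAt ℂ (fun z ↦ p (z - w)) w :=
    hp.fun_comp_of_eq (f := fun z ↦ z - w) (by fun_prop) (sub_self w)
  set r : ℂ → ℂ := fun z ↦ c + ∑ i, wzeta τ (z - a i) -
    ∑ l ∈ Finset.univ.erase k, (n l : ℂ) * wzeta τ (z - omega τ l / 2) - n k * s (z - w) with hr
  set D : ℂ → ℂ := fun z ↦ -∑ i, wp τ (z - a i) +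
    ∑ l ∈ Finset.univ.erase k, (n l : ℂ) * wp τ (z - omega τ l / 2) + n k * p (z - w) with hD
  set g : ℂ → ℂ := fun z ↦ ∑ l ∈ Finset.univ.erase k,
    (n l : ℂ) * ((n l : ℂ) + 1) * wp τ (z - omega τ l / 2) +
      (n k : ℂ) * ((n k : ℂ) + 1) * p (z - w) + B with hg
  have hra : AnalyticAt ℂ r w :=
    ((analyticAt_const.fun_add (Finset.analyticAt_fun_sum _ fun i _ ↦
      analyticAt_wzeta_sub τ (ha' i))).fun_sub (Finset.analyticAt_fun_sum _ fun l hl ↦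
      analyticAt_const.fun_mul (analyticAt_wzeta_sub τ (ho l hl)))).fun_sub
      (analyticAt_const.fun_mul hs')
  have hDa : AnalyticAt ℂ D w :=
    ((Finset.analyticAt_fun_sum _ fun i _ ↦ analyticAt_wp_sub τ (ha' i)).fun_neg.fun_add
      (Finset.analyticAt_fun_sum _ fun l hl ↦
      analyticAt_const.fun_mul (analyticAt_wp_sub τ (ho l hl)))).fun_add
      (analyticAt_const.fun_mul hp')
  have hga : AnalyticAt ℂ g w :=
    ((Finset.analyticAt_fun_sum _ fun l hl ↦
      analyticAt_const.fun_mul (analyticAt_wp_sub τ (ho l hl))).fun_add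
      (analyticAt_const.fun_mul hp')).fun_add analyticAt_const
  refine ⟨fun z ↦ -2 * n k * r z + (z - w) * (D z + r z ^ 2 - g z), by fun_prop, ?_, ?_⟩
  · simp [hr, hs0]
  · filter_upwards [self_mem_nhdsWithin] with z hz
    have hz : z - w ≠ 0 := sub_ne_zero.mpr hz
    -- With principal part `-n_k / (z - w)` in `L`, the double pole of `L' + L²` is `n_k + n_k²`,
    -- exactly that of the potential. Only the cross term `-2 n_k r / (z - w)` of the square
    -- survives, which gives the residue.
    have e1 : logAnsatz τ n a c z = -(n k) / (z - w) + r z := by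
      rw [logAnsatz, ← Finset.add_sum_erase _ _ (Finset.mem_univ k), ← hw, hζ (z - w), hr]
      ring
    have e2 : logAnsatzDeriv τ n a z = n k / (z - w) ^ 2 + D z := by
      rw [logAnsatzDeriv, ← Finset.add_sum_erase _ _ (Finset.mem_univ k), ← hw, h℘ (z - w), hD]
      ring
    have e3 : potential n B τ z = n k * (n k + 1) / (z - w) ^ 2 + g z := by
      rw [potential_eq, ← Finset.add_sum_erase _ _ (Finset.mem_univ k), ← hw, h℘ (z - w), hg]
      ring
    rw [riccati, e1, e2, e3]
    field_simp
    ring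

lemma sum_erase_zero_eta : ∑ k ∈ ({1, 2, 3} : Finset (Fin 4)), (n k : ℂ) * eta τ k =
    2 * ∑ k ∈ Finset.univ.erase 0, (n k : ℂ) * wzeta τ (omega τ k / 2) := by
  rw [show ({1, 2, 3} : Finset (Fin 4)) = Finset.univ.erase 0 by decide, Finset.mul_sum]
  exact Finset.sum_congr rfl fun k _ ↦ by rw [eta]; ring

/-- The exponent of a solution of the form of the ansatz is determined by `a`. -/
theorem eq_cOf_of_isSolution (hn : 1 ≤ n 0) (ha : ∀ i, a i ∉ twoTorsion τ) {B : ℂ}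
    (h : IsSolution n B τ (ansatz n τ a c)) : c = cOf n τ a := by
  rw [isSolution_ansatz_iff] at h
  obtain ⟨m, hm, hm0, hmz⟩ := exists_residue τ (n := n) c B 0 ha
  have h0 : m (omega τ 0 / 2) = 0 := by
    refine tendsto_nhds_unique (hm.continuousAt.tendsto.mono_left nhdsWithin_le_nhds)
      ((tendsto_const_nhds (x := (0 : ℂ)) (f := 𝓝[≠] (omega τ 0 / 2))).congr' ?_)
    filter_upwards [hmz, eventually_mem_genericSet τ (a := a) (omega τ 0 / 2)] with z h1 h2
    rw [← h1, h z h2, sub_self, mul_zero]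
  -- The exponent is read off from the residue at `0`, so `n 0` has to be nonzero.
  have hn0 : (n 0 : ℂ) ≠ 0 := by
    norm_cast; omega
  rw [hm0] at h0
  have h1 := (mul_eq_zero.mp h0).resolve_left (by simpa using hn0)
  have hw : omega τ 0 / 2 = 0 := by simp [omega]
  simp only [hw, zero_sub, wzeta_neg, mul_neg, Finset.sum_neg_distrib] at h1
  rw [cOf, sum_erase_zero_eta]
  linear_combination h1

end LogDeriv

/-! ### Parity of `y'' / y` and the Wronskian criterion -/

section Parity

open Polynomial

variable (n : Fin 4 → ℕ) {N : ℕ} (a : Fin N → ℂ)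

/-- `∏_{k = 1, 2, 3} (X - e_k)^{n_k}`. -/
def branchPoly : ℂ[X] := ∏ k ∈ Finset.univ.erase 0, (X - C (e τ k)) ^ n k

lemma monic_branchPoly : (branchPoly τ n).Monic :=
  monic_prod_of_monic _ _ fun _ _ ↦ (monic_X_sub_C _).pow _

lemma natDegree_branchPoly : (branchPoly τ n).natDegree = ∑ k ∈ Finset.univ.erase 0, n k := by
  rw [branchPoly, natDegree_prod_of_monic _ _ fun _ _ ↦ (monic_X_sub_C _).pow _]
  simp

lemma eval_derivative_prod_X_sub_C_pow {ι : Type*} [DecidableEq ι] (s : Finset ι) (b : ι → ℂ)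
    (m : ι → ℕ) {x : ℂ} (h : ∀ k ∈ s, x ≠ b k) :
    (derivative (∏ k ∈ s, (X - C (b k)) ^ m k)).eval x =
      (∏ k ∈ s, (X - C (b k)) ^ m k).eval x * ∑ k ∈ s, (m k : ℂ) / (x - b k) := by
  induction s using Finset.induction_on with
  | empty => simp
  | insert k s hk ih =>
    have hx := sub_ne_zero.mpr (h k (Finset.mem_insert_self k s))
    rw [Finset.prod_insert hk, Finset.sum_insert hk, derivative_mul, eval_add, eval_mul, eval_mul,
      ih fun j hj ↦ h j (Finset.mem_insert_of_mem hj), eval_mul]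
    have : (derivative ((X - C (b k)) ^ m k)).eval x =
        ((X - C (b k)) ^ m k).eval x * (m k / (x - b k)) := by
      rcases m k with _ | m
      · simp
      · simp only [derivative_X_sub_C_pow, eval_mul, eval_pow, eval_sub, eval_X, eval_C,
          Nat.add_sub_cancel]
        field_simp
        ring
    rw [this]
    ring

lemma eval_nodeSum (x c : Fin N → ℂ) {t : ℂ} (h : ∀ i, t ≠ x i) :
    (nodeSum x c).eval t = (nodePoly x).eval t * ∑ i, c i / (t - x i) := by
  rw [nodeSum, eval_finsetSum, Finset.mul_sum]
  refine Finset.sum_congr rfl fun i _ ↦ ?_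
  have := sub_ne_zero.mpr (h i)
  rw [← mul_nodePolyErase x i]
  simp only [eval_mul, eval_C, eval_sub, eval_X]
  field_simp

lemma eval_nodePoly_ne_zero (x : Fin N → ℂ) {t : ℂ} (h : ∀ i, t ≠ x i) :
    (nodePoly x).eval t ≠ 0 := by
  rw [nodePoly, eval_prod]
  exact Finset.prod_ne_zero_iff.mpr fun i _ ↦ by simpa using sub_ne_zero.mpr (h i)

lemma eval_derivative_nodePoly (x : Fin N → ℂ) {t : ℂ} (h : ∀ i, t ≠ x i) :
    (derivative (nodePoly x)).eval t = (nodePoly x).eval t * ∑ i, 1 / (t - x i) := by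
  simpa [nodePoly] using eval_derivative_prod_X_sub_C_pow Finset.univ x (fun _ ↦ 1)
    (x := t) (fun i _ ↦ h i)

/-- `∏_i (X - ℘(a_i))`. -/
abbrev nodes : ℂ[X] := nodePoly fun i ↦ wp τ (a i)

/-- `∑_i ℘'(a_i) ∏_{j ≠ i} (X - ℘(a_j))`. -/
abbrev weightedNodes : ℂ[X] := nodeSum (fun i ↦ wp τ (a i)) fun i ↦ wpDeriv τ (a i)

variable {n a}

lemma wp_ne_wp_of_mem_genericSet (ha : ∀ i, a i ∉ Lam τ) {z : ℂ} (hz : z ∈ genericSet τ a)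
    (i : Fin N) : wp τ z ≠ wp τ (a i) :=
  wp_ne_wp τ (ha i) (notMem_Lam_of_two_mul τ hz.1) (hz.2 i).1 (hz.2 i).2

lemma wp_ne_e_of_mem_genericSet {z : ℂ} (hz : z ∈ genericSet τ a) {k : Fin 4} (hk : k ≠ 0) :
    wp τ z ≠ e τ k :=
  wp_ne_wp τ (half_omega_notMem_Lam τ hk) (notMem_Lam_of_two_mul τ hz.1)
    (sub_half_omega_notMem τ hz.1 k) (add_half_omega_notMem τ hz.1 k)

lemma eval_branchPoly_ne_zero {z : ℂ} (hz : z ∈ genericSet τ a) :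
    (branchPoly τ n).eval (wp τ z) ≠ 0 := by
  rw [branchPoly, eval_prod]
  refine Finset.prod_ne_zero_iff.mpr fun k hk ↦ ?_
  simpa using fun h ↦ absurd h (sub_ne_zero.mpr (wp_ne_e_of_mem_genericSet τ hz
    (Finset.ne_of_mem_erase hk)))

lemma logAnsatz_neg (c z : ℂ) : logAnsatz τ n a c (-z) =
    c - ∑ i, wzeta τ (z + a i) + ∑ k, (n k : ℂ) * wzeta τ (z + omega τ k / 2) := by
  simp only [logAnsatz, show ∀ b : ℂ, -z - b = -(z + b) by intro b; ring, wzeta_neg, mul_neg,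
    Finset.sum_neg_distrib]
  ring

/-- The odd part of the addition formula rewrites each `ζ(z - a_i) - ζ(z + a_i)` up to `-2 ζ(a_i)`.
At half periods it has no rational part because `℘'` vanishes there. The exponent `c(a)` is the one
for which all these constants cancel. -/
lemma logAnsatz_add_logAnsatz_neg (ha : ∀ i, a i ∉ Lam τ) {z : ℂ} (hz : z ∈ genericSet τ a) :
    logAnsatz τ n a (cOf n τ a) z + logAnsatz τ n a (cOf n τ a) (-z) =
      (weightedNodes τ a).eval (wp τ z) / (nodes τ a).eval (wp τ z) := by
  have hz0 := notMem_Lam_of_two_mul τ hz.1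
  have hne := wp_ne_wp_of_mem_genericSet τ ha hz
  rw [eval_nodeSum _ _ hne, mul_div_cancel_left₀ _ (eval_nodePoly_ne_zero _ hne)]
  have h1 : ∀ i, wpDeriv τ (a i) / (wp τ z - wp τ (a i)) =
      wzeta τ (z - a i) - wzeta τ (z + a i) + 2 * wzeta τ (a i) := fun i ↦ by
    rw [div_eq_iff (sub_ne_zero.mpr (hne i)),
      wzeta_sub_sub_wzeta_add_mul τ (ha i) hz0 (hz.2 i).1 (hz.2 i).2]
  have h2 : ∀ k ∈ Finset.univ.erase (0 : Fin 4), (n k : ℂ) * wzeta τ (z + omega τ k / 2) =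
      n k * wzeta τ (z - omega τ k / 2) + 2 * (n k * wzeta τ (omega τ k / 2)) := fun k hk ↦ by
    have hk' := Finset.ne_of_mem_erase hk
    have := wzeta_sub_sub_wzeta_add_mul τ (half_omega_notMem_Lam τ hk') hz0
      (sub_half_omega_notMem τ hz.1 k) (add_half_omega_notMem τ hz.1 k)
    rw [wpDeriv_half_omega, mul_eq_zero] at this
    linear_combination (-(n k : ℂ)) * this.resolve_right
      (sub_ne_zero.mpr (wp_ne_e_of_mem_genericSet τ hz hk'))
  rw [logAnsatz_neg, logAnsatz, cOf, sum_erase_zero_eta, Finset.sum_congr rfl fun i _ ↦ h1 i,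
    Finset.sum_add_distrib, Finset.sum_sub_distrib, ← Finset.mul_sum,
    ← Finset.add_sum_erase _ (fun k ↦ (n k : ℂ) * wzeta τ (z + omega τ k / 2)) (Finset.mem_univ 0),
    ← Finset.add_sum_erase _ (fun k ↦ (n k : ℂ) * wzeta τ (z - omega τ k / 2)) (Finset.mem_univ 0),
    Finset.sum_congr rfl h2, Finset.sum_add_distrib, ← Finset.mul_sum]
  simp only [omega, Matrix.cons_val_zero, zero_div, add_zero, sub_zero]
  ring

/-- The exponent drops out, and the even part of the addition formula applies. The multiples of
`ζ(z)` balance precisely because `N = ∑ n_k`. -/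
lemma logAnsatz_sub_logAnsatz_neg (c : ℂ) (hN : N = ∑ k, n k) (ha : ∀ i, a i ∉ Lam τ) {z : ℂ}
    (hz : z ∈ genericSet τ a) :
    logAnsatz τ n a c z - logAnsatz τ n a c (-z) = wpDeriv τ z *
      ((derivative (nodes τ a)).eval (wp τ z) / (nodes τ a).eval (wp τ z) -
        (derivative (branchPoly τ n)).eval (wp τ z) / (branchPoly τ n).eval (wp τ z)) := by
  have hz0 := notMem_Lam_of_two_mul τ hz.1
  have hne := wp_ne_wp_of_mem_genericSet τ ha hz
  have hne' : ∀ k ∈ Finset.univ.erase (0 : Fin 4), wp τ z ≠ e τ k := fun k hk ↦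
    wp_ne_e_of_mem_genericSet τ hz (Finset.ne_of_mem_erase hk)
  have hB : (derivative (branchPoly τ n)).eval (wp τ z) = (branchPoly τ n).eval (wp τ z) *
      ∑ k ∈ Finset.univ.erase 0, (n k : ℂ) / (wp τ z - e τ k) :=
    eval_derivative_prod_X_sub_C_pow _ _ _ hne'
  rw [eval_derivative_nodePoly _ hne, hB,
    mul_div_cancel_left₀ _ (eval_nodePoly_ne_zero _ hne),
    mul_div_cancel_left₀ _ (eval_branchPoly_ne_zero τ hz), mul_sub, Finset.mul_sum, Finset.mul_sum]
  have h1 : ∀ i, wpDeriv τ z * (1 / (wp τ z - wp τ (a i))) =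
      wzeta τ (z - a i) + wzeta τ (z + a i) - 2 * wzeta τ z := fun i ↦ by
    rw [mul_one_div, div_eq_iff (sub_ne_zero.mpr (hne i)),
      wzeta_sub_add_wzeta_add_mul τ (ha i) hz0 (hz.2 i).1 (hz.2 i).2]
  have h2 : ∀ k ∈ Finset.univ.erase (0 : Fin 4), wpDeriv τ z * (n k / (wp τ z - e τ k)) =
      n k * wzeta τ (z - omega τ k / 2) + n k * wzeta τ (z + omega τ k / 2) -
        n k * (2 * wzeta τ z) := fun k hk ↦ by
    rw [mul_div_assoc', div_eq_iff (sub_ne_zero.mpr (hne' k hk)), e,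
      ← wzeta_sub_add_wzeta_add_mul τ (half_omega_notMem_Lam τ (Finset.ne_of_mem_erase hk)) hz0
        (sub_half_omega_notMem τ hz.1 k) (add_half_omega_notMem τ hz.1 k)]
    ring
  have hN' : (N : ℂ) = n 0 + ∑ k ∈ Finset.univ.erase 0, (n k : ℂ) := by
    rw [Finset.add_sum_erase _ (fun k ↦ (n k : ℂ)) (Finset.mem_univ 0), hN]
    push_cast; rfl
  have hs : ∑ k ∈ Finset.univ.erase 0, (n k : ℂ) * (2 * wzeta τ z) =
      (∑ k ∈ Finset.univ.erase 0, (n k : ℂ)) * (2 * wzeta τ z) := (Finset.sum_mul ..).symm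
  rw [logAnsatz_neg, logAnsatz, Finset.sum_congr rfl fun i _ ↦ h1 i, Finset.sum_congr rfl h2,
    Finset.sum_sub_distrib, Finset.sum_add_distrib, Finset.sum_sub_distrib, Finset.sum_add_distrib,
    ← Finset.add_sum_erase _ (fun k ↦ (n k : ℂ) * wzeta τ (z + omega τ k / 2)) (Finset.mem_univ 0),
    ← Finset.add_sum_erase _ (fun k ↦ (n k : ℂ) * wzeta τ (z - omega τ k / 2)) (Finset.mem_univ 0),
    hs, Finset.sum_const, Finset.card_univ, Fintype.card_fin, nsmul_eq_mul]
  simp only [omega, Matrix.cons_val_zero, zero_div, add_zero, sub_zero]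
  linear_combination (2 * wzeta τ z) * hN'

/-- The odd part of `y'' / y` as a Wronskian. -/
theorem riccati_sub_riccati_neg (hN : N = ∑ k, n k) (ha : ∀ i, a i ∉ Lam τ) {z : ℂ}
    (hz : z ∈ genericSet τ a) :
    riccati τ n a (cOf n τ a) z - riccati τ n a (cOf n τ a) (-z) = wpDeriv τ z *
      ((derivative (weightedNodes τ a) * branchPoly τ n -
        weightedNodes τ a * derivative (branchPoly τ n)).eval (wp τ z)) /
        ((nodes τ a).eval (wp τ z) * (branchPoly τ n).eval (wp τ z)) := by
  have hz0 := notMem_Lam_of_two_mul τ hz.1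
  have hQ := eval_nodePoly_ne_zero _ (wp_ne_wp_of_mem_genericSet τ ha hz)
  have hR := eval_branchPoly_ne_zero (n := n) τ hz
  have hd1 : HasDerivAt (fun z ↦ logAnsatz τ n a (cOf n τ a) z + logAnsatz τ n a (cOf n τ a) (-z))
      (logAnsatzDeriv τ n a z - logAnsatzDeriv τ n a (-z)) z := by
    have h := (hasDerivAt_logAnsatz (n := n) τ (cOf n τ a) (neg_mem_genericSet τ hz)).comp z
      (hasDerivAt_neg z)
    refine ((hasDerivAt_logAnsatz (n := n) τ (cOf n τ a) hz).add h).congr_deriv ?_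
    ring
  have hd2 : HasDerivAt
      (fun z ↦ (weightedNodes τ a).eval (wp τ z) / (nodes τ a).eval (wp τ z))
      (((derivative (weightedNodes τ a)).eval (wp τ z) * wpDeriv τ z * (nodes τ a).eval (wp τ z) -
        (weightedNodes τ a).eval (wp τ z) *
          ((derivative (nodes τ a)).eval (wp τ z) * wpDeriv τ z)) /
        (nodes τ a).eval (wp τ z) ^ 2) z :=
    (((weightedNodes τ a).hasDerivAt (wp τ z)).comp z (hasDerivAt_wp τ hz0)).fun_div
      (((nodes τ a).hasDerivAt (wp τ z)).comp z (hasDerivAt_wp τ hz0)) hQ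
  have hd := hd1.unique (hd2.congr_of_eventuallyEq (by
    filter_upwards [(isOpen_genericSet τ).mem_nhds hz] with w hw
      using logAnsatz_add_logAnsatz_neg τ ha hw))
  -- With `S` and `D` the sum and difference of `L(z)` and `L(-z)`, the odd part is `S' + S D`. For
  -- `S = W / Q` and `D = ℘' (Q' / Q - R' / R)` the terms in `Q'` cancel.
  have e1 : riccati τ n a (cOf n τ a) z - riccati τ n a (cOf n τ a) (-z) =
      (logAnsatzDeriv τ n a z - logAnsatzDeriv τ n a (-z)) +
      (logAnsatz τ n a (cOf n τ a) z + logAnsatz τ n a (cOf n τ a) (-z)) *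
      (logAnsatz τ n a (cOf n τ a) z - logAnsatz τ n a (cOf n τ a) (-z)) := by
    unfold riccati; ring
  rw [e1, hd, logAnsatz_add_logAnsatz_neg τ ha hz, logAnsatz_sub_logAnsatz_neg τ _ hN ha hz]
  simp only [eval_sub, eval_mul]
  field_simp
  ring

/-- `y'' / y` is even if and only if the two polynomials are proportional. -/
theorem riccati_neg_iff (hN : N = ∑ k, n k) (ha : ∀ i, a i ∉ Lam τ) :
    (∀ z ∈ genericSet τ a, riccati τ n a (cOf n τ a) z = riccati τ n a (cOf n τ a) (-z)) ↔
      ∃ b, weightedNodes τ a = C b * branchPoly τ n := by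
  constructor
  · intro h
    refine exists_eq_C_mul_of_wronskian_eq_zero (monic_branchPoly τ n) (sub_eq_zero.mp
      (polynomial_eq_zero_of_eventually τ ?_))
    filter_upwards [eventually_mem_genericSet τ (a := a) 0, eventually_wpDeriv_ne_zero τ]
      with z hz hz'
    have h1 := riccati_sub_riccati_neg τ hN ha hz
    rw [h z hz, sub_self, eq_comm, div_eq_zero_iff, mul_eq_zero, or_iff_right hz'] at h1
    exact h1.resolve_right (mul_ne_zero
      (eval_nodePoly_ne_zero _ (wp_ne_wp_of_mem_genericSet τ ha hz)) (eval_branchPoly_ne_zero τ hz))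
  · rintro ⟨b, hb⟩ z hz
    rw [← sub_eq_zero, riccati_sub_riccati_neg τ hN ha hz, hb]
    simp only [derivative_C_mul]
    rw [show C b * derivative (branchPoly τ n) * branchPoly τ n -
      C b * branchPoly τ n * derivative (branchPoly τ n) = 0 by ring]
    simp

/-- Proportionality of the two polynomials in terms of power sums. -/
theorem weightedNodes_eq_C_mul_iff (hn : 1 ≤ n 0) (hN : N = ∑ k, n k)
    (ha : ∀ i, a i ∉ twoTorsion τ) :
    (∃ b, weightedNodes τ a = C b * branchPoly τ n) ↔
      (∀ l : ℕ, l + 2 ≤ n 0 → ∑ i, wpDeriv τ (a i) * wp τ (a i) ^ l = 0) ∧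
        ∀ k : Fin 4, k ≠ 0 → ∀ l : ℕ, 1 ≤ l → l ≤ n k →
          ∑ i, wpDeriv τ (a i) *
            ∏ j ∈ Finset.univ.erase i, (wp τ (a j) - e τ k) ^ l = 0 := by
  have hN' : N = n 0 + ∑ k ∈ Finset.univ.erase 0, n k := by
    rw [Finset.add_sum_erase _ _ (Finset.mem_univ 0), hN]
  have hne : ∀ k : Fin 4, k ≠ 0 → ∀ i, wp τ (a i) ≠ e τ k := fun k hk i ↦ by
    have h2 : 2 * a i ∉ Lam τ := fun h ↦ ha i ((mem_twoTorsion_iff τ).mpr h)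
    exact wp_ne_wp τ (half_omega_notMem_Lam τ hk) (notMem_Lam_of_two_mul τ h2)
      (sub_half_omega_notMem τ h2 k) (add_half_omega_notMem τ h2 k)
  -- For `n 0 ≥ 1` the bound `N - (n 0 - 1)` is `deg R + 1`, so the strict inequality means `deg W ≤
  -- deg R`.
  have hA : (∀ l : ℕ, l + 2 ≤ n 0 → ∑ i, wpDeriv τ (a i) * wp τ (a i) ^ l = 0) ↔
      (weightedNodes τ a).degree < ((N - (n 0 - 1) : ℕ) : WithBot ℕ) := by
    rw [degree_nodeSum_iff _ _ _ (by omega)]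
    exact forall_congr' fun l ↦ ⟨fun h h' ↦ h (by omega), fun h h' ↦ h (by omega)⟩
  have hB : (∀ k : Fin 4, k ≠ 0 → ∀ l : ℕ, 1 ≤ l → l ≤ n k → ∑ i, wpDeriv τ (a i) *
      ∏ j ∈ Finset.univ.erase i, (wp τ (a j) - e τ k) ^ l = 0) ↔
      ∀ k : Fin 4, k ≠ 0 → (X - C (e τ k)) ^ n k ∣ weightedNodes τ a := by
    refine forall_congr' fun k ↦ forall_congr' fun hk ↦ ?_
    rw [X_sub_C_pow_dvd_nodeSum_iff _ _ (hne k hk)]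
    refine forall_congr' fun l ↦ forall_congr' fun _ ↦ forall_congr' fun _ ↦ ?_
    rw [sum_mul_prod_erase_pow _ _ (hne k hk), mul_eq_zero, or_iff_right]
    exact Finset.prod_ne_zero_iff.mpr fun i _ ↦ pow_ne_zero _ (sub_ne_zero.mpr (hne k hk i))
  rw [hA, hB]
  have hR := monic_branchPoly τ n
  have hRd : (branchPoly τ n).degree = ((N - n 0 : ℕ) : WithBot ℕ) := by
    rw [degree_eq_natDegree hR.ne_zero, natDegree_branchPoly, hN', Nat.add_sub_cancel_left]
  constructor
  · rintro ⟨b, hb⟩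
    refine ⟨?_, fun k hk ↦ ?_⟩
    · rw [hb, ← smul_eq_C_mul]
      refine (degree_smul_le _ _).trans_lt ?_
      rw [hRd]
      norm_cast
      omega
    · rw [hb]
      exact (Finset.dvd_prod_of_mem (fun k ↦ (X - C (e τ k)) ^ n k) (by simpa using hk)).mul_left _
  · rintro ⟨h1, h2⟩
    -- The `e_k` are distinct, so the prime-power divisors combine; the degree bound then leaves
    -- only a constant quotient.
    have hdvd : branchPoly τ n ∣ weightedNodes τ a := by
      refine Finset.prod_dvd_of_coprime (fun j hj k hk hjk ↦ ?_) fun k hk ↦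
        h2 k (Finset.ne_of_mem_erase hk)
      exact (isCoprime_X_sub_C_of_isUnit_sub (sub_ne_zero.mpr (e_injOn τ
        (Finset.ne_of_mem_erase hj) (Finset.ne_of_mem_erase hk) hjk)).isUnit).pow
    obtain ⟨q, hq⟩ := hdvd
    by_cases hq0 : q = 0
    · exact ⟨0, by rw [hq, hq0]; simp⟩
    · have hqd : q.degree ≤ 0 := by
        rw [hq, degree_mul, hRd, degree_eq_natDegree hq0] at h1
        rw [degree_eq_natDegree hq0]
        norm_cast at h1 ⊢
        omega
      exact ⟨q.coeff 0, by rw [hq, mul_comm, ← eq_C_of_degree_le_zero hqd]⟩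

end Parity

/-! ### Solutions from evenness -/

section Evenness

variable {n : Fin 4 → ℕ} {N : ℕ} {a : Fin N → ℂ}

lemma analyticAt_riccati (c : ℂ) {z : ℂ} (hz : 2 * z ∉ Lam τ) (hza : ∀ i, z - a i ∉ Lam τ) :
    AnalyticAt ℂ (riccati τ n a c) z := by
  have h1 : AnalyticAt ℂ (logAnsatz τ n a c) z :=
    (analyticAt_const.fun_add (Finset.analyticAt_fun_sum _ fun i _ ↦
      analyticAt_wzeta_sub τ (hza i))).fun_sub (Finset.analyticAt_fun_sum _ fun k _ ↦
      analyticAt_const.fun_mul (analyticAt_wzeta_sub τ (sub_half_omega_notMem τ hz k)))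
  have h2 : AnalyticAt ℂ (logAnsatzDeriv τ n a) z :=
    (Finset.analyticAt_fun_sum _ fun i _ ↦ analyticAt_wp_sub τ (hza i)).fun_neg.fun_add
      (Finset.analyticAt_fun_sum _ fun k _ ↦
      analyticAt_const.fun_mul (analyticAt_wp_sub τ (sub_half_omega_notMem τ hz k)))
  exact h2.fun_add (h1.fun_pow 2)

/-- `L` contains `N` terms `ζ` with sign plus and `∑ n_k` with sign minus, so a lattice translation
changes it by `(N - ∑ n_k) h = 0`. -/
lemma riccati_add (c : ℂ) (hN : N = ∑ k, n k) {l : ℂ} (hl : l ∈ Lam τ) {z : ℂ}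
    (hz : z ∈ genericSet τ a) : riccati τ n a c (z + l) = riccati τ n a c z := by
  obtain ⟨h, hh⟩ := exists_wzeta_add τ hl
  have e0 : ∀ b : ℂ, z + l - b = z - b + l := fun b ↦ by ring
  have hN' : (N : ℂ) = ∑ k, (n k : ℂ) := by rw [hN]; push_cast; rfl
  have e1 : logAnsatz τ n a c (z + l) = logAnsatz τ n a c z := by
    have s1 : ∑ i, wzeta τ (z - a i + l) = ∑ i, wzeta τ (z - a i) + N * h := by
      rw [Finset.sum_congr rfl fun i _ ↦ hh _ (hz.2 i).1, Finset.sum_add_distrib]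
      simp
    have s2 : ∑ k, (n k : ℂ) * wzeta τ (z - omega τ k / 2 + l) =
        ∑ k, (n k : ℂ) * wzeta τ (z - omega τ k / 2) + (∑ k, (n k : ℂ)) * h := by
      rw [Finset.sum_mul, ← Finset.sum_add_distrib]
      exact Finset.sum_congr rfl fun k _ ↦ by
        rw [hh _ (sub_half_omega_notMem τ hz.1 k), mul_add]
    simp only [logAnsatz, e0]
    rw [s1, s2, hN']
    ring
  have e2 : logAnsatzDeriv τ n a (z + l) = logAnsatzDeriv τ n a z := by
    simp only [logAnsatzDeriv, e0, wp_add τ hl]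
  rw [riccati, riccati, e1, e2]

lemma potential_add (B : ℂ) {l : ℂ} (hl : l ∈ Lam τ) (z : ℂ) :
    potential n B τ (z + l) = potential n B τ z := by
  simp only [potential_eq, show ∀ b : ℂ, z + l - b = z - b + l by intro b; ring, wp_add τ hl]

lemma potential_neg (B z : ℂ) : potential n B τ (-z) = potential n B τ z := by
  rw [potential_eq, potential]
  simp only [show ∀ b : ℂ, -z - b = -(z + b) by intro b; ring, wp_neg]

/-- Evenness removes every pole of the elliptic function `y'' / y - I_n`, and Liouville's theorem
supplies `B`. The potential is taken with `B = 0` until the constant is known. -/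
theorem exists_riccati_eq_potential (hN : N = ∑ k, n k) (ha : ∀ i, a i ∉ twoTorsion τ)
    (haa : ∀ i j, i ≠ j → a i - a j ∉ Lam τ ∧ a i + a j ∉ Lam τ) (c : ℂ)
    (heven : ∀ z ∈ genericSet τ a, riccati τ n a c z = riccati τ n a c (-z)) :
    ∃ B, ∀ z ∈ genericSet τ a, riccati τ n a c z = potential n B τ z := by
  have hH : ∀ {z : ℂ}, 2 * z ∉ Lam τ → (∀ i, z - a i ∉ Lam τ) →
      AnalyticAt ℂ (fun z ↦ riccati τ n a c z - potential n 0 τ z) z := fun hz hza ↦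
    (analyticAt_riccati τ c hz hza).fun_sub
      (analyticAt_potential τ 0 fun k _ ↦ sub_half_omega_notMem τ hz k)
  rsuffices ⟨B, hB⟩ : ∃ B, ∀ z₀, ∀ᶠ z in 𝓝[≠] z₀, riccati τ n a c z - potential n 0 τ z = B
  · refine ⟨B, fun z hz ↦ ?_⟩
    have h1 := tendsto_nhdsNE_of_eventuallyEq_analyticAt (hH hz.1 fun i ↦ (hz.2 i).1)
      EventuallyEq.rfl
    have h2 := tendsto_nhds_unique h1
      (tendsto_const_nhds.congr' ((hB z).mono fun _ h ↦ h.symm))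
    rw [sub_eq_iff_eq_add] at h2
    rw [h2, potential, potential]
    ring
  refine exists_eventually_eq_const τ ?_ ?_
  · intro l hl z₀
    filter_upwards [eventually_mem_genericSet τ (a := a) z₀] with z hz
    rw [riccati_add τ c hN hl hz, potential_add τ 0 hl]
  · intro z₀
    by_cases hz : 2 * z₀ ∈ Lam τ
    · obtain ⟨k, hk⟩ := (mem_twoTorsion_iff τ).mpr hz
      refine ⟨-(z₀ - omega τ k / 2), neg_mem hk, ?_⟩
      rw [show z₀ + -(z₀ - omega τ k / 2) = omega τ k / 2 by ring]
      obtain ⟨m, hm, -, hmz⟩ := exists_residue τ (n := n) c 0 k ha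
      set w := omega τ k / 2 with hw
      have hrefl : Tendsto (fun z ↦ 2 * w - z) (𝓝[≠] w) (𝓝[≠] w) := by
        refine tendsto_nhdsWithin_of_tendsto_nhds_of_eventually_within _ ?_ ?_
        · have : Tendsto (fun z ↦ 2 * w - z) (𝓝 w) (𝓝 (2 * w - w)) :=
            Continuous.tendsto (by fun_prop) w
          rw [show 2 * w - w = w by ring] at this
          exact this.mono_left nhdsWithin_le_nhds
        · filter_upwards [self_mem_nhdsWithin] with z hz h
          exact hz (by simp only [mem_singleton_iff] at h ⊢; linear_combination -h)
      -- Evenness together with the period `2w` makes the difference symmetric about `w`. Multiplied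
      -- by `z - w` it becomes antisymmetric, so its value at `w`, the residue, is zero.
      have hodd : ∀ᶠ z in 𝓝[≠] w, m (2 * w - z) = -m z := by
        filter_upwards [hmz, hrefl.eventually hmz, eventually_mem_genericSet τ (a := a) w]
          with z h1 h2 h3
        have hlat : 2 * w ∈ Lam τ := two_mul_half_omega τ k
        rw [show 2 * w - z = -z + 2 * w by ring] at h2 ⊢
        rw [← h1, ← h2, riccati_add τ c hN hlat (neg_mem_genericSet τ h3), potential_add τ 0 hlat,
          potential_neg, ← heven z h3]
        ring
      have hmt : Tendsto m (𝓝[≠] w) (𝓝 (m w)) :=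
        hm.continuousAt.tendsto.mono_left nhdsWithin_le_nhds
      have hm0 : m w = 0 := CharZero.eq_neg_self_iff.mp
        (tendsto_nhds_unique ((hmt.comp hrefl).congr' hodd) hmt.neg)
      obtain ⟨g, hg, hgm⟩ := exists_eq_sub_mul hm hm0
      refine ⟨g, hg, ?_⟩
      filter_upwards [hmz, nhdsWithin_le_nhds hgm, self_mem_nhdsWithin] with z h1 h2 h3
      rw [h2] at h1
      exact mul_left_cancel₀ (sub_ne_zero.mpr h3) h1
    · by_cases hza : ∃ i, z₀ - a i ∈ Lam τ
      · obtain ⟨i, hi⟩ := hza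
        refine ⟨-(z₀ - a i), neg_mem hi, ?_⟩
        rw [show z₀ + -(z₀ - a i) = a i by ring]
        have h2 : 2 * a i ∉ Lam τ := fun h ↦ ha i ((mem_twoTorsion_iff τ).mpr h)
        -- The extension across `a_i` is the reflected function: `-a_i` is congruent to no `a_j`, by
        -- `haa` for `j ≠ i` and because `a_i` is not two-torsion for `j = i`.
        refine ⟨fun z ↦ riccati τ n a c (-z) - potential n 0 τ (-z), ?_, ?_⟩
        · refine (hH (z := -a i) ?_ fun j ↦ ?_).fun_comp_of_eq (f := fun z ↦ -z) (by fun_prop) rfl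
          · rwa [mul_neg, neg_mem_Lam_iff]
          · rw [show -a i - a j = -(a i + a j) by ring, neg_mem_Lam_iff]
            by_cases hij : i = j
            · rwa [← hij, ← two_mul]
            · exact (haa i j hij).2
        · filter_upwards [eventually_mem_genericSet τ (a := a) (a i)] with z hz
          rw [potential_neg, ← heven z hz]
      · push Not at hza
        exact ⟨0, zero_mem _, _, by rw [add_zero]; exact hH hz hza, EventuallyEq.rfl⟩

end Evenness

/-- Evenness of `y'' / y` is the bridge: it is necessary because the potential is even, sufficient
by `exists_riccati_eq_potential`, and equivalent to the sums through the proportionality of `W` and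
`R`. -/
theorem exists_isSolution_iff {n : Fin 4 → ℕ} (hn : 1 ≤ n 0) {N : ℕ} (hN : N = ∑ k, n k)
    {a : Fin N → ℂ} (ha : ∀ i, a i ∉ twoTorsion τ)
    (haa : ∀ i j, i ≠ j → a i - a j ∉ Lam τ ∧ a i + a j ∉ Lam τ) :
    (∃ B, IsSolution n B τ (ansatz n τ a (cOf n τ a))) ↔
      (∀ l : ℕ, l + 2 ≤ n 0 → ∑ i, wpDeriv τ (a i) * wp τ (a i) ^ l = 0) ∧
        ∀ k : Fin 4, k ≠ 0 → ∀ l : ℕ, 1 ≤ l → l ≤ n k →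
          ∑ i, wpDeriv τ (a i) *
            ∏ j ∈ Finset.univ.erase i, (wp τ (a j) - e τ k) ^ l = 0 := by
  have ha' : ∀ i, a i ∉ Lam τ := fun i h ↦ ha i ⟨0, by simpa [omega] using h⟩
  rw [← weightedNodes_eq_C_mul_iff τ hn hN ha, ← riccati_neg_iff τ hN ha']
  simp only [isSolution_ansatz_iff]
  constructor
  · rintro ⟨B, hB⟩ z hz
    rw [hB z hz, hB _ (neg_mem_genericSet τ hz), potential_neg]
  · exact exists_riccati_eq_potential τ hN ha haa _

end GeneralizedLame

end

theorem theorem2p1 (τ : UpperHalfPlane) (n : Fin 4 → ℕ) (hn : 1 ≤ n 0)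
    (N : ℕ) (hN : N = ∑ k, n k) (a : Fin N → ℂ)
    (ha : ∀ i, a i ∉ GeneralizedLame.twoTorsion τ)
    (haa : ∀ i j, i ≠ j → a i - a j ∉ GeneralizedLame.Lam τ ∧ a i + a j ∉ GeneralizedLame.Lam τ) :
    ((∃ B : ℂ, GeneralizedLame.IsSolution n B τ
        (GeneralizedLame.ansatz n τ a (GeneralizedLame.cOf n τ a))) ↔
      ((∀ l : ℕ, l + 2 ≤ n 0 →
          ∑ i, GeneralizedLame.wpDeriv τ (a i) * GeneralizedLame.wp τ (a i) ^ l = 0) ∧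
        (∀ k : Fin 4, k ≠ 0 → ∀ l : ℕ, 1 ≤ l → l ≤ n k →
          ∑ i, GeneralizedLame.wpDeriv τ (a i) *
            ∏ j ∈ Finset.univ.erase i,
              (GeneralizedLame.wp τ (a j) - GeneralizedLame.e τ k) ^ l = 0))) ∧
    ((∃ c B : ℂ, GeneralizedLame.IsSolution n B τ (GeneralizedLame.ansatz n τ a c)) ↔
      ((∀ l : ℕ, l + 2 ≤ n 0 →
          ∑ i, GeneralizedLame.wpDeriv τ (a i) * GeneralizedLame.wp τ (a i) ^ l = 0) ∧
        (∀ k : Fin 4, k ≠ 0 → ∀ l : ℕ, 1 ≤ l → l ≤ n k →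
          ∑ i, GeneralizedLame.wpDeriv τ (a i) *
            ∏ j ∈ Finset.univ.erase i,
              (GeneralizedLame.wp τ (a j) - GeneralizedLame.e τ k) ^ l = 0))) := by
  refine ⟨GeneralizedLame.exists_isSolution_iff τ hn hN ha haa, ?_⟩
  rw [← GeneralizedLame.exists_isSolution_iff τ hn hN ha haa]
  constructor
  · rintro ⟨c, B, h⟩
    obtain rfl := GeneralizedLame.eq_cOf_of_isSolution τ c hn ha h
    exact ⟨B, h⟩
  · rintro ⟨B, h⟩
    exact ⟨_, B, h⟩
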